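/- Let $F:\mathbb{R}^2\to\mathbb{R}^2$ be a quadratic map, i.e. $$F(x,y)=(a_0x^2+a_1xy+a_2y^2+a_3x+a_4y+a_5,\; b_0x^2+b_1xy+b_2y^2+b_3x+b_4y+b_5)$$ with real coefficients such that at least one of $a_0,a_1,a_2,b_0,b_1,b_2$ is nonzero. Let $J_0=\{p\in\mathbb{R}^2 : \det DF(p)=0\}$ be its critical set and $J_1=F(J_0)$ its critical image. Conventions. A cusp of a smooth parametrized plane curve $\gamma$ at $t_0$ means: the unit tangent vector has one-sided limits at $t_0$ which are opposite to each other, and there are linearly independent vectors $u,v$ with $\gamma(t)=\gamma(t_0)+(t-t_0)^2u+(t-t_0)^3v+o((t-t_0)^3)$ (a cusp of order $3/2$). Curves are understood to be without self-intersections: a (non-closed) curve is the image of a $C^\infty$ map $\gamma:\mathbb{R}\to\mathbb{R}^2$ which is a homeomorphism onto its image, and a closed curve is the image of a $C^\infty$, $2\pi$-periodic map which is injective on $[0,2\pi)$; it is smooth away from the parameters $t$ with $\gamma'(t)=0$. Ellipses (circles included), hyperbolas and parabolas are nondegenerate, lines and rays have nonzero direction. Then exactly one of the following fifteen statements holds (so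 that $F$ belongs to exactly one of the classes 1–9, and to exactly one subcase of its class): 1. $J_0$ is empty and $J_1$ is empty. 2. $J_0$ is a point and $J_1$ is a point. 3. $J_0$ is an ellipse and $J_1$ is a closed curve which is smooth except for exactly three cusps. 4. $J_0$ is a hyperbola, and $J_1$ consists of two disjoint curves, the images of the two branches of the hyperbola; one of them is smooth, the other is smooth except for a single cusp. 5. $J_0$ is a pair of intersecting lines, and $J_1$ is (a) the union of two non-collinear rays emanating from the same point, or (b) the union of a ray and a parabola whose only common point is the endpoint of the ray. 6. $J_0$ is a parabola and $J_1$ is a curve which is smooth except for a single cusp. 7. $J_0$ is a pair of parallel lines: (a) two distinct lines, one of which is mapped onto a line $L$ and the other to a point $z\notin L$, so that $J_1=L\cup\{z\}$; or (b) two coincident lines (that is, $J_0$ is a line and $\det DF=c\,\ell^2$ with $c\neq0$ and $\ell$ a nonconstant affine function), and $J_1$ is a point. 8. $J_0$ is a simple line (that is, $J_0$ is a line and $\det DF$ is a nonconstant affine function), and $J_1$ is (a) a point, (b) a line, or (c) a parabola. (In particular $J_1$ is never a ray.) 9. $J_0=\mathbb{R}^2$, and $J_1$ is (a) a line, (b)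 a ray, or (c) a parabola. Every case occurs. The following are quadratic maps belonging to the indicated cases: 1: $(1-ax^2+y,\,bx)$ with $a\neq0$, $b\ne0$; 2: $(x^2-y^2+c_1,\,2xy+c_2)$ and $(x^2-y^2+c_1,\,xy+c_2)$ for all real $c_1,c_2$; 3: $(x^2-y^2+2x,\,2xy-2y)$; 4: $(x^2+y^2+2x,\,2xy-2y)$; 5(a): $(x^2,y^2)$; 5(b): $(x^2+y,\,y^2)$; 6: $(\tfrac12x^2+y,\,xy)$; 7(a): $(\tfrac12x^2+\varepsilon x,\,xy-\varepsilon y)$ with $\varepsilon\ne0$; 7(b): $(\tfrac12x^2,\,xy)$; 8(a): $(x,xy)$; 8(b): $(x^2,y)$; 8(c): $(x^2+y^2,\,y)$; 9(a): $(x^2-y^2,0)$; 9(b): $(x^2,0)$; 9(c): $(x^2,x)$. -/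

import Mathlib

open Set Filter Topology Asymptotics
open scoped ContDiff

namespace QuadPlane

noncomputable section

/-! ### Quadratic maps of the plane, critical set, critical image -/

/-- The general map of the plane with polynomial components of degree at most two. -/
def quadMap (a b : Fin 6 → ℝ) (p : ℝ × ℝ) : ℝ × ℝ :=
  (a 0 * p.1 ^ 2 + a 1 * p.1 * p.2 + a 2 * p.2 ^ 2 + a 3 * p.1 + a 4 * p.2 + a 5,
   b 0 * p.1 ^ 2 + b 1 * p.1 * p.2 + b 2 * p.2 ^ 2 + b 3 * p.1 + b 4 * p.2 + b 5)

/-- A quadratic map of the plane: at least one of the six quadratic coefficients is nonzero. -/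
def IsQuadraticMap (F : ℝ × ℝ → ℝ × ℝ) : Prop :=
  ∃ a b : Fin 6 → ℝ,
    (a 0 ≠ 0 ∨ a 1 ≠ 0 ∨ a 2 ≠ 0 ∨ b 0 ≠ 0 ∨ b 1 ≠ 0 ∨ b 2 ≠ 0) ∧ F = quadMap a b

/-- The Jacobian determinant `det (DF (x, y))`. -/
def jac (F : ℝ × ℝ → ℝ × ℝ) (p : ℝ × ℝ) : ℝ := (fderiv ℝ F p).det

/-- The critical set. -/
def J0 (F : ℝ × ℝ → ℝ × ℝ) : Set (ℝ × ℝ) := {p | jac F p = 0}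

/-- The critical image. -/
def J1 (F : ℝ × ℝ → ℝ × ℝ) : Set (ℝ × ℝ) := F '' J0 F

/-! ### Points, lines, rays, conics -/

def IsPoint (S : Set (ℝ × ℝ)) : Prop := ∃ p, S = {p}

/-- The line through `p` with direction `v` (a line when `v ≠ 0`). -/
def line (p v : ℝ × ℝ) : Set (ℝ × ℝ) := {q | ∃ t : ℝ, q = p + t • v}

/-- The closed ray from `p` in direction `v` (a ray when `v ≠ 0`). -/
def ray (p v : ℝ × ℝ) : Set (ℝ × ℝ) := {q | ∃ t : ℝ, 0 ≤ t ∧ q = p + t • v}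

def IsLine (S : Set (ℝ × ℝ)) : Prop := ∃ p v, v ≠ 0 ∧ S = line p v

def IsRay (S : Set (ℝ × ℝ)) : Prop := ∃ p v, v ≠ 0 ∧ S = ray p v

/-- Ellipses (circles included) are the affine images of the unit circle. -/
def IsEllipse (S : Set (ℝ × ℝ)) : Prop :=
  ∃ φ : (ℝ × ℝ) ≃ᵃ[ℝ] (ℝ × ℝ), S = φ '' {p | p.1 ^ 2 + p.2 ^ 2 = 1}

/-- Nondegenerate parabolas are the affine images of `y = x ^ 2`. -/
def IsParabola (S : Set (ℝ × ℝ)) : Prop :=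
  ∃ φ : (ℝ × ℝ) ≃ᵃ[ℝ] (ℝ × ℝ), S = φ '' {p | p.2 = p.1 ^ 2}

/-- `B₁` and `B₂` are the two branches of a (nondegenerate) hyperbola, that is, of an affine
image of `x * y = 1`. -/
def AreHyperbolaBranches (B₁ B₂ : Set (ℝ × ℝ)) : Prop :=
  ∃ φ : (ℝ × ℝ) ≃ᵃ[ℝ] (ℝ × ℝ),
    B₁ = φ '' {p | p.1 * p.2 = 1 ∧ 0 < p.1} ∧ B₂ = φ '' {p | p.1 * p.2 = 1 ∧ p.1 < 0}

/-- Two lines meeting in exactly one point. -/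
def IsIntersectingLines (S : Set (ℝ × ℝ)) : Prop :=
  ∃ p u v, LinearIndependent ℝ ![u, v] ∧ S = line p u ∪ line p v

/-- Two rays, not on a common line, emanating from the same point. -/
def IsTwoRays (S : Set (ℝ × ℝ)) : Prop :=
  ∃ p u v, LinearIndependent ℝ ![u, v] ∧ S = ray p u ∪ ray p v

/-- The union of a ray and a parabola which share exactly one point, the endpoint of the ray. -/
def IsRayAndParabola (S : Set (ℝ × ℝ)) : Prop :=
  ∃ (p v : ℝ × ℝ) (P : Set (ℝ × ℝ)),
    v ≠ 0 ∧ IsParabola P ∧ ray p v ∩ P = {p} ∧ S = ray p v ∪ P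

/-! ### Smooth curves and cusps -/

/-- The vector `v` divided by its Euclidean length. -/
def unitVec (v : ℝ × ℝ) : ℝ × ℝ := (√(v.1 ^ 2 + v.2 ^ 2))⁻¹ • v

/-- The curve `γ` has a cusp (of order `3/2`) at the parameter `t₀`: the unit tangent has limits
on both sides and they are opposite, so both sides have a common tangent line and the tangent
vector switches direction; and in suitable linear coordinates centred at `γ t₀` the leading terms
of `γ` are `((t - t₀) ^ 2, (t - t₀) ^ 3)`. -/
def IsCuspAt (γ : ℝ → ℝ × ℝ) (t₀ : ℝ) : Prop :=
  (∃ w : ℝ × ℝ, w ≠ 0 ∧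
    Tendsto (fun t => unitVec (deriv γ t)) (𝓝[>] t₀) (𝓝 w) ∧
    Tendsto (fun t => unitVec (deriv γ t)) (𝓝[<] t₀) (𝓝 (-w))) ∧
  ∃ u v : ℝ × ℝ, LinearIndependent ℝ ![u, v] ∧
    (fun t => γ t - γ t₀ - (t - t₀) ^ 2 • u - (t - t₀) ^ 3 • v) =o[𝓝 t₀]
      (fun t => (t - t₀) ^ 3)

/-- `S` is a smooth curve without self-intersections (smoothly parametrized by the real line). -/
def IsSmoothCurve (S : Set (ℝ × ℝ)) : Prop :=
  ∃ γ : ℝ → ℝ × ℝ, ContDiff ℝ ∞ γ ∧ IsEmbedding γ ∧ range γ = S ∧ ∀ t, deriv γ t ≠ 0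

/-- `S` is a curve without self-intersections which is smooth except for exactly one cusp. -/
def IsOneCuspCurve (S : Set (ℝ × ℝ)) : Prop :=
  ∃ γ : ℝ → ℝ × ℝ, ContDiff ℝ ∞ γ ∧ IsEmbedding γ ∧ range γ = S ∧
    ∃ t₀, IsCuspAt γ t₀ ∧ ∀ t, t ≠ t₀ → deriv γ t ≠ 0

/-- `S` is a simple closed curve which is smooth except for exactly three cusps. -/
def IsThreeCuspClosedCurve (S : Set (ℝ × ℝ)) : Prop :=
  ∃ γ : ℝ → ℝ × ℝ, ContDiff ℝ ∞ γ ∧ Function.Periodic γ (2 * Real.pi) ∧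
    InjOn γ (Ico 0 (2 * Real.pi)) ∧ range γ = S ∧
    ∃ c : Finset ℝ, c.card = 3 ∧ (c : Set ℝ) ⊆ Ico 0 (2 * Real.pi) ∧
      (∀ t ∈ c, IsCuspAt γ t) ∧ ∀ t ∈ Ico 0 (2 * Real.pi), t ∉ c → deriv γ t ≠ 0

/-! ### The line as a critical set, with multiplicity -/

/-- The critical set is a pair of coincident lines: it is a line, and the Jacobian determinant is
a nonzero multiple of the square of a nonconstant affine function. -/
def J0IsCoincidentLines (F : ℝ × ℝ → ℝ × ℝ) : Prop :=
  IsLine (J0 F) ∧ ∃ (l : (ℝ × ℝ) →ᵃ[ℝ] ℝ) (c : ℝ),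
    l.linear ≠ 0 ∧ c ≠ 0 ∧ ∀ p, jac F p = c * l p ^ 2

/-- The critical set is a simple line: it is a line, and the Jacobian determinant is a nonconstant
affine function (it has degree one). -/
def J0IsSimpleLine (F : ℝ × ℝ → ℝ × ℝ) : Prop :=
  IsLine (J0 F) ∧ ∃ l : (ℝ × ℝ) →ᵃ[ℝ] ℝ, l.linear ≠ 0 ∧ ∀ p, jac F p = l p

/-! ### The list of cases -/

/-- Nine classes according to the critical set; the fifth, seventh, eighth and ninth are split
according to subcases. -/
inductive Form
  | c1 | c2 | c3 | c4 | c5a | c5b | c6 | c7a | c7b | c8a | c8b | c8c | c9a | c9b | c9c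

/-- The pair `(J0 F, J1 F)` has the given form. -/
def HasForm (F : ℝ × ℝ → ℝ × ℝ) : Form → Prop
  | .c1 => J0 F = ∅ ∧ J1 F = ∅
  | .c2 => IsPoint (J0 F) ∧ IsPoint (J1 F)
  | .c3 => IsEllipse (J0 F) ∧ IsThreeCuspClosedCurve (J1 F)
  | .c4 => ∃ B₁ B₂, AreHyperbolaBranches B₁ B₂ ∧ J0 F = B₁ ∪ B₂ ∧
      IsSmoothCurve (F '' B₁) ∧ IsOneCuspCurve (F '' B₂) ∧ Disjoint (F '' B₁) (F '' B₂) ∧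
      J1 F = F '' B₁ ∪ F '' B₂
  | .c5a => IsIntersectingLines (J0 F) ∧ IsTwoRays (J1 F)
  | .c5b => IsIntersectingLines (J0 F) ∧ IsRayAndParabola (J1 F)
  | .c6 => IsParabola (J0 F) ∧ IsOneCuspCurve (J1 F)
  | .c7a => ∃ p q v, v ≠ 0 ∧ Disjoint (line p v) (line q v) ∧ J0 F = line p v ∪ line q v ∧
      ∃ (L : Set (ℝ × ℝ)) (z : ℝ × ℝ), IsLine L ∧ z ∉ L ∧ F '' line p v = L ∧
        F '' line q v = {z} ∧ J1 F = L ∪ {z}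
  | .c7b => J0IsCoincidentLines F ∧ IsPoint (J1 F)
  | .c8a => J0IsSimpleLine F ∧ IsPoint (J1 F)
  | .c8b => J0IsSimpleLine F ∧ IsLine (J1 F)
  | .c8c => J0IsSimpleLine F ∧ IsParabola (J1 F)
  | .c9a => J0 F = univ ∧ IsLine (J1 F)
  | .c9b => J0 F = univ ∧ IsRay (J1 F)
  | .c9c => J0 F = univ ∧ IsParabola (J1 F)

/-- `F` is a quadratic map which is an example of the given form. -/
def IsExample (F : ℝ × ℝ → ℝ × ℝ) (c : Form) : Prop := IsQuadraticMap F ∧ HasForm F c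

end

end QuadPlane

open QuadPlane

/-!
The list of forms is complete and irredundant, for the following reasons.

*Invariance.* If `F = φ ∘ G ∘ ψ` with affine automorphisms `φ` and `ψ` of the plane, then the
Jacobian determinants differ by a nonzero factor and the substitution `ψ`, so that critical sets and
critical images correspond under `ψ⁻¹` and `φ`. Lines, rays, conics, smooth curves and cusps are
affine notions (for a cusp: the direction of the image of a vector under a linear map depends
continuously on the direction of the vector). Hence the form of `F` is that of `G`
(`HasForm.conj`).

*Existence.* The leading parts of the components span a line or a plane in the space of binary
quadratic forms. After a linear change of coordinates the line is spanned by `x²` or `x² + δ y²`,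
and the plane contains a nonzero form divisible by `y`, from which it is seen to be spanned by
`x², y²`, by `x² - y², x y`, or by `x², x y`. A translation then removes most of the linear terms,
and scaling leaves a short list of normal forms (`isClassifiedPencil_of_ne_zero`). In complex
notation the plane `x² - y², x y` leads to `z² + β conj z`, where `β` is normalized to `0` or `2` by
extracting a complex cube root.

*Normal forms.* Only three of them have curved images that are not conics. The map
`z² + 2 conj z` has the unit circle as its critical set, and maps it injectively to the deltoid.
The map `(x² + 2 y, y² + 2 x)` has the critical set `x y = 1`; each branch is parametrized by
exponentials, and a linear functional increases along the image of each. The map `(x²/2 + y, x y)`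
maps the parabola `y = x²` to a semicubical parabola. Cusps are detected by linear independence of
the second and third derivatives (`isCuspAt_of_hasDerivAt`).

*Uniqueness.* A few affine invariants (containing a line, being collinear, compact, connected)
determine the shape of the critical set (`shapeOf`), and in most cases that of the critical image.
The remaining pairs are separated by the degree of the Jacobian determinant, and by the fact that
a parabola does not lie on two lines.
-/

namespace QuadPlane

/-! ### Affine images of lines, rays, conics and independent pairs -/

lemma affineEquiv_add (φ : (ℝ × ℝ) ≃ᵃ[ℝ] (ℝ × ℝ)) (p v : ℝ × ℝ) :
    φ (p + v) = φ p + φ.linear v := by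
  have := φ.map_vadd p v
  simpa [add_comm] using this

lemma image_line (φ : (ℝ × ℝ) ≃ᵃ[ℝ] (ℝ × ℝ)) (p v : ℝ × ℝ) :
    φ '' line p v = line (φ p) (φ.linear v) := by
  ext q
  constructor
  · rintro ⟨_, ⟨t, rfl⟩, rfl⟩
    exact ⟨t, by rw [affineEquiv_add, map_smul]⟩
  · rintro ⟨t, rfl⟩
    exact ⟨p + t • v, ⟨t, rfl⟩, by rw [affineEquiv_add, map_smul]⟩

lemma image_ray (φ : (ℝ × ℝ) ≃ᵃ[ℝ] (ℝ × ℝ)) (p v : ℝ × ℝ) :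
    φ '' ray p v = ray (φ p) (φ.linear v) := by
  ext q
  constructor
  · rintro ⟨_, ⟨t, ht, rfl⟩, rfl⟩
    exact ⟨t, ht, by rw [affineEquiv_add, map_smul]⟩
  · rintro ⟨t, ht, rfl⟩
    exact ⟨p + t • v, ⟨t, ht, rfl⟩, by rw [affineEquiv_add, map_smul]⟩

lemma linearIndependent_pair_map (L : (ℝ × ℝ) ≃ₗ[ℝ] (ℝ × ℝ)) {u v : ℝ × ℝ}
    (h : LinearIndependent ℝ ![u, v]) : LinearIndependent ℝ ![L u, L v] := by
  rw [LinearIndependent.pair_iff] at h ⊢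
  intro s t hst
  refine h s t (L.injective ?_)
  simpa using hst

lemma linear_ne_zero (φ : (ℝ × ℝ) ≃ᵃ[ℝ] (ℝ × ℝ)) {v : ℝ × ℝ} (hv : v ≠ 0) : φ.linear v ≠ 0 :=
  (map_ne_zero_iff _ φ.linear.injective).2 hv

section Image

variable {S : Set (ℝ × ℝ)} (φ : (ℝ × ℝ) ≃ᵃ[ℝ] (ℝ × ℝ))

lemma IsPoint.image (h : IsPoint S) : IsPoint (φ '' S) := by
  obtain ⟨p, rfl⟩ := h
  exact ⟨φ p, image_singleton⟩

lemma IsLine.image (h : IsLine S) : IsLine (φ '' S) := by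
  obtain ⟨p, v, hv, rfl⟩ := h
  exact ⟨_, _, linear_ne_zero φ hv, image_line φ p v⟩

lemma IsRay.image (h : IsRay S) : IsRay (φ '' S) := by
  obtain ⟨p, v, hv, rfl⟩ := h
  exact ⟨_, _, linear_ne_zero φ hv, image_ray φ p v⟩

lemma IsEllipse.image (h : IsEllipse S) : IsEllipse (φ '' S) := by
  obtain ⟨ψ, rfl⟩ := h
  exact ⟨ψ.trans φ, by simp [image_image]⟩

lemma IsParabola.image (h : IsParabola S) : IsParabola (φ '' S) := by
  obtain ⟨ψ, rfl⟩ := h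
  exact ⟨ψ.trans φ, by simp [image_image]⟩

lemma AreHyperbolaBranches.image {B₁ B₂ : Set (ℝ × ℝ)} (h : AreHyperbolaBranches B₁ B₂) :
    AreHyperbolaBranches (φ '' B₁) (φ '' B₂) := by
  obtain ⟨ψ, rfl, rfl⟩ := h
  exact ⟨ψ.trans φ, by simp [image_image], by simp [image_image]⟩

lemma IsIntersectingLines.image (h : IsIntersectingLines S) : IsIntersectingLines (φ '' S) := by
  obtain ⟨p, u, v, huv, rfl⟩ := h
  exact ⟨_, _, _, linearIndependent_pair_map φ.linear huv, by
    rw [image_union, image_line, image_line]⟩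

lemma IsTwoRays.image (h : IsTwoRays S) : IsTwoRays (φ '' S) := by
  obtain ⟨p, u, v, huv, rfl⟩ := h
  exact ⟨_, _, _, linearIndependent_pair_map φ.linear huv, by
    rw [image_union, image_ray, image_ray]⟩

lemma IsRayAndParabola.image (h : IsRayAndParabola S) : IsRayAndParabola (φ '' S) := by
  obtain ⟨p, v, P, hv, hP, hi, rfl⟩ := h
  refine ⟨_, _, _, linear_ne_zero φ hv, hP.image φ, ?_, by rw [image_union, image_ray]⟩
  rw [← image_ray, ← image_inter φ.injective, hi, image_singleton]

end Image

/-! ### Affine images of curves and cusps -/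

lemma hasFDerivAt_affineEquiv (φ : (ℝ × ℝ) ≃ᵃ[ℝ] (ℝ × ℝ)) (p : ℝ × ℝ) :
    HasFDerivAt φ (LinearMap.toContinuousLinearMap φ.linear.toLinearMap) p := by
  have h : (φ : ℝ × ℝ → ℝ × ℝ) =
      fun q => LinearMap.toContinuousLinearMap φ.linear.toLinearMap q + φ 0 := by
    funext q
    have := affineEquiv_add φ 0 q
    simpa [add_comm] using this
  rw [h]
  exact (ContinuousLinearMap.hasFDerivAt _).add_const _

lemma contDiff_affineEquiv (φ : (ℝ × ℝ) ≃ᵃ[ℝ] (ℝ × ℝ)) : ContDiff ℝ ∞ φ := by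
  have h : (φ : ℝ × ℝ → ℝ × ℝ) =
      fun q => LinearMap.toContinuousLinearMap φ.linear.toLinearMap q + φ 0 := by
    funext q
    have := affineEquiv_add φ 0 q
    simpa [add_comm] using this
  rw [h]
  exact (ContinuousLinearMap.contDiff _).add contDiff_const

lemma continuous_affineEquiv (φ : (ℝ × ℝ) ≃ᵃ[ℝ] (ℝ × ℝ)) : Continuous φ :=
  (contDiff_affineEquiv φ).continuous

lemma isEmbedding_affineEquiv (φ : (ℝ × ℝ) ≃ᵃ[ℝ] (ℝ × ℝ)) : IsEmbedding φ := by
  refine .of_leftInverse (f := φ.symm) (fun x => by simp) (continuous_affineEquiv φ.symm)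
    (continuous_affineEquiv φ)

lemma hasDerivAt_affineEquiv_comp (φ : (ℝ × ℝ) ≃ᵃ[ℝ] (ℝ × ℝ)) {γ : ℝ → ℝ × ℝ} {v : ℝ × ℝ} {t : ℝ}
    (h : HasDerivAt γ v t) : HasDerivAt (φ ∘ γ) (φ.linear v) t :=
  (hasFDerivAt_affineEquiv φ (γ t)).comp_hasDerivAt t h

lemma deriv_affineEquiv_comp (φ : (ℝ × ℝ) ≃ᵃ[ℝ] (ℝ × ℝ)) {γ : ℝ → ℝ × ℝ}
    (h : Differentiable ℝ γ) (t : ℝ) : deriv (φ ∘ γ) t = φ.linear (deriv γ t) :=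
  (hasDerivAt_affineEquiv_comp φ (h t).hasDerivAt).deriv

lemma sq_add_sq_pos {v : ℝ × ℝ} (hv : v ≠ 0) : 0 < v.1 ^ 2 + v.2 ^ 2 := by
  by_contra h
  apply hv
  have h1 : v.1 = 0 := by nlinarith [sq_nonneg v.1, sq_nonneg v.2]
  have h2 : v.2 = 0 := by nlinarith [sq_nonneg v.1, sq_nonneg v.2]
  exact Prod.ext h1 h2

lemma unitVec_smul {c : ℝ} (hc : 0 < c) (v : ℝ × ℝ) : unitVec (c • v) = unitVec v := by
  have h : √((c • v).1 ^ 2 + (c • v).2 ^ 2) = c * √(v.1 ^ 2 + v.2 ^ 2) := by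
    rw [show (c • v).1 ^ 2 + (c • v).2 ^ 2 = c ^ 2 * (v.1 ^ 2 + v.2 ^ 2) by
      simp only [Prod.smul_fst, Prod.smul_snd, smul_eq_mul]; ring,
      Real.sqrt_mul (sq_nonneg c), Real.sqrt_sq hc.le]
  rw [unitVec, unitVec, h, smul_smul, mul_inv, mul_right_comm, inv_mul_cancel₀ hc.ne', one_mul]

lemma unitVec_neg (v : ℝ × ℝ) : unitVec (-v) = -unitVec v := by simp [unitVec]

lemma unitVec_ne_zero {v : ℝ × ℝ} (hv : v ≠ 0) : unitVec v ≠ 0 :=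
  smul_ne_zero (inv_ne_zero (Real.sqrt_pos.2 (sq_add_sq_pos hv)).ne') hv

lemma unitVec_zero : unitVec 0 = 0 := by simp [unitVec]

lemma continuousAt_unitVec {v : ℝ × ℝ} (hv : v ≠ 0) : ContinuousAt unitVec v := by
  unfold unitVec
  have h : ContinuousAt (fun v : ℝ × ℝ => √(v.1 ^ 2 + v.2 ^ 2)) v := by fun_prop
  refine ContinuousAt.smul (h.inv₀ ?_) continuousAt_id
  exact (Real.sqrt_pos.2 (sq_add_sq_pos hv)).ne'

/-- The direction of the image of a vector under a linear map depends on the direction of the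
vector only. -/
lemma unitVec_map_unitVec (L : (ℝ × ℝ) ≃ₗ[ℝ] (ℝ × ℝ)) (v : ℝ × ℝ) :
    unitVec (L (unitVec v)) = unitVec (L v) := by
  by_cases hv : v = 0
  · simp [hv, unitVec_zero]
  · rw [unitVec.eq_def v, map_smul, unitVec_smul (inv_pos.2 (Real.sqrt_pos.2 (sq_add_sq_pos hv)))]

lemma tendsto_unitVec_map (L : (ℝ × ℝ) ≃ₗ[ℝ] (ℝ × ℝ)) {f : ℝ → ℝ × ℝ} {l : Filter ℝ}
    {w : ℝ × ℝ} (hw : w ≠ 0) (h : Tendsto (fun t => unitVec (f t)) l (𝓝 w)) :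
    Tendsto (fun t => unitVec (L (f t))) l (𝓝 (unitVec (L w))) := by
  have hL : Continuous L := L.toLinearMap.continuous_of_finiteDimensional
  have := ((continuousAt_unitVec (v := L w) ((map_ne_zero_iff _ L.injective).2 hw)).tendsto.comp
    (hL.tendsto w)).comp h
  refine this.congr fun t => ?_
  exact unitVec_map_unitVec L (f t)

lemma IsCuspAt.affineEquiv_comp (φ : (ℝ × ℝ) ≃ᵃ[ℝ] (ℝ × ℝ)) {γ : ℝ → ℝ × ℝ} {t₀ : ℝ}
    (hγ : Differentiable ℝ γ) (h : IsCuspAt γ t₀) : IsCuspAt (φ ∘ γ) t₀ := by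
  obtain ⟨⟨w, hw, hr, hl⟩, u, v, huv, ho⟩ := h
  refine ⟨⟨unitVec (φ.linear w), unitVec_ne_zero (linear_ne_zero φ hw), ?_, ?_⟩,
    φ.linear u, φ.linear v, linearIndependent_pair_map φ.linear huv, ?_⟩
  · simp only [deriv_affineEquiv_comp φ hγ]
    exact tendsto_unitVec_map φ.linear hw hr
  · simp only [deriv_affineEquiv_comp φ hγ]
    rw [← unitVec_neg, ← map_neg]
    exact tendsto_unitVec_map φ.linear (neg_ne_zero.2 hw) hl
  · have h1 := ((LinearMap.toContinuousLinearMap φ.linear.toLinearMap).isBigO_comp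
      (fun t => γ t - γ t₀ - (t - t₀) ^ 2 • u - (t - t₀) ^ 3 • v) (𝓝 t₀)).trans_isLittleO ho
    refine h1.congr_left fun t => ?_
    have h2 := affineEquiv_add φ (γ t₀) (γ t - γ t₀)
    simp only [add_sub_cancel] at h2
    simp [h2]

lemma IsSmoothCurve.image {S : Set (ℝ × ℝ)} (φ : (ℝ × ℝ) ≃ᵃ[ℝ] (ℝ × ℝ)) (h : IsSmoothCurve S) :
    IsSmoothCurve (φ '' S) := by
  obtain ⟨γ, hγ, he, rfl, hd⟩ := h
  refine ⟨φ ∘ γ, (contDiff_affineEquiv φ).comp hγ, (isEmbedding_affineEquiv φ).comp he,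
    range_comp _ _, fun t => ?_⟩
  rw [deriv_affineEquiv_comp φ (hγ.differentiable (by simp))]
  exact linear_ne_zero φ (hd t)

lemma IsOneCuspCurve.image {S : Set (ℝ × ℝ)} (φ : (ℝ × ℝ) ≃ᵃ[ℝ] (ℝ × ℝ)) (h : IsOneCuspCurve S) :
    IsOneCuspCurve (φ '' S) := by
  obtain ⟨γ, hγ, he, rfl, t₀, hc, hd⟩ := h
  have hD : Differentiable ℝ γ := hγ.differentiable (by simp)
  refine ⟨φ ∘ γ, (contDiff_affineEquiv φ).comp hγ, (isEmbedding_affineEquiv φ).comp he,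
    range_comp _ _, t₀, hc.affineEquiv_comp φ hD, fun t ht => ?_⟩
  rw [deriv_affineEquiv_comp φ hD]
  exact linear_ne_zero φ (hd t ht)

lemma IsThreeCuspClosedCurve.image {S : Set (ℝ × ℝ)} (φ : (ℝ × ℝ) ≃ᵃ[ℝ] (ℝ × ℝ))
    (h : IsThreeCuspClosedCurve S) : IsThreeCuspClosedCurve (φ '' S) := by
  obtain ⟨γ, hγ, hper, hinj, rfl, c, hc3, hcs, hc, hd⟩ := h
  have hD : Differentiable ℝ γ := hγ.differentiable (by simp)
  refine ⟨φ ∘ γ, (contDiff_affineEquiv φ).comp hγ, hper.comp φ, φ.injective.comp_injOn hinj,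
    range_comp _ _, c, hc3, hcs, fun t ht => (hc t ht).affineEquiv_comp φ hD, fun t ht htc => ?_⟩
  rw [deriv_affineEquiv_comp φ hD]
  exact linear_ne_zero φ (hd t ht htc)

/-! ### Affine equivalence of maps -/

section Transport

variable {F G : ℝ × ℝ → ℝ × ℝ} {φ ψ : (ℝ × ℝ) ≃ᵃ[ℝ] (ℝ × ℝ)}

lemma jac_conj (hG : Differentiable ℝ G) (h : ∀ p, F p = φ (G (ψ p))) (p : ℝ × ℝ) :
    jac F p = LinearMap.det φ.linear.toLinearMap * LinearMap.det ψ.linear.toLinearMap *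
      jac G (ψ p) := by
  have h1 : HasFDerivAt F ((LinearMap.toContinuousLinearMap φ.linear.toLinearMap).comp
      ((fderiv ℝ G (ψ p)).comp (LinearMap.toContinuousLinearMap ψ.linear.toLinearMap))) p := by
    rw [show F = φ ∘ G ∘ ψ from funext h]
    exact (hasFDerivAt_affineEquiv φ _).comp p
      ((hG (ψ p)).hasFDerivAt.comp p (hasFDerivAt_affineEquiv ψ p))
  rw [jac, h1.fderiv, jac, ContinuousLinearMap.det, ContinuousLinearMap.det]
  simp only [ContinuousLinearMap.toLinearMap_comp, LinearMap.det_comp]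
  simp only [LinearMap.coe_toContinuousLinearMap]
  ring

lemma det_linear_ne_zero (φ : (ℝ × ℝ) ≃ᵃ[ℝ] (ℝ × ℝ)) : LinearMap.det φ.linear.toLinearMap ≠ 0 :=
  (LinearEquiv.isUnit_det' φ.linear).ne_zero

lemma J0_conj (hG : Differentiable ℝ G) (h : ∀ p, F p = φ (G (ψ p))) :
    J0 F = ψ.symm '' J0 G := by
  ext p
  have hp : p ∈ J0 F ↔ ψ p ∈ J0 G := by
    simp only [J0, mem_ofPred_eq]
    rw [jac_conj hG h, mul_eq_zero, or_iff_right
      (mul_ne_zero (det_linear_ne_zero φ) (det_linear_ne_zero ψ))]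
  rw [hp]
  constructor
  · intro hp
    exact ⟨ψ p, hp, by simp⟩
  · rintro ⟨q, hq, rfl⟩
    simpa using hq

lemma image_conj (h : ∀ p, F p = φ (G (ψ p))) (B : Set (ℝ × ℝ)) :
    F '' (ψ.symm '' B) = φ '' (G '' B) := by
  simp [image_image, h]

lemma J1_conj (hG : Differentiable ℝ G) (h : ∀ p, F p = φ (G (ψ p))) : J1 F = φ '' J1 G := by
  rw [J1, J1, J0_conj hG h, image_conj h]

lemma linear_comp_ne_zero {l : (ℝ × ℝ) →ᵃ[ℝ] ℝ} (hl : l.linear ≠ 0) :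
    (l.comp ψ.toAffineMap).linear ≠ 0 := by
  intro h
  apply hl
  ext
  · have := LinearMap.congr_fun h (ψ.linear.symm (1, 0))
    simpa using this
  · have := LinearMap.congr_fun h (ψ.linear.symm (0, 1))
    simpa using this

/-- The form of a quadratic map is invariant under affine changes of coordinates in the source
and in the target. -/
lemma HasForm.conj {c : Form} (hc : HasForm G c) (hG : Differentiable ℝ G)
    (h : ∀ p, F p = φ (G (ψ p))) : HasForm F c := by
  have e0 := J0_conj hG h
  have e1 := J1_conj hG h
  have eb := image_conj h
  cases c <;> simp only [HasForm] at hc ⊢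
  case c1 => rw [e0, e1]; simpa only [image_eq_empty] using hc
  case c2 => rw [e0, e1]; exact ⟨hc.1.image _, hc.2.image _⟩
  case c3 => rw [e0, e1]; exact ⟨hc.1.image _, hc.2.image _⟩
  case c4 =>
    obtain ⟨B₁, B₂, hB, h0, hs, ho, hd, h1⟩ := hc
    refine ⟨_, _, hB.image ψ.symm, ?_, ?_, ?_, ?_, ?_⟩
    · rw [e0, h0, image_union]
    · rw [eb]; exact hs.image φ
    · rw [eb]; exact ho.image φ
    · rw [eb, eb]; exact (disjoint_image_iff φ.injective).2 hd
    · rw [e1, eb, eb, h1, image_union]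
  case c5a => rw [e0, e1]; exact ⟨hc.1.image _, hc.2.image _⟩
  case c5b => rw [e0, e1]; exact ⟨hc.1.image _, hc.2.image _⟩
  case c6 => rw [e0, e1]; exact ⟨hc.1.image _, hc.2.image _⟩
  case c7a =>
    obtain ⟨p, q, v, hv, hd, h0, L, z, hL, hz, hp, hq, h1⟩ := hc
    refine ⟨ψ.symm p, ψ.symm q, _, linear_ne_zero ψ.symm hv, ?_, ?_, φ '' L, φ z, hL.image φ,
      ?_, ?_, ?_, ?_⟩
    · rw [← image_line, ← image_line]
      exact (disjoint_image_iff ψ.symm.injective).2 hd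
    · rw [← image_line, ← image_line, e0, h0, image_union]
    · rwa [φ.injective.mem_set_image]
    · rw [← image_line, eb, hp]
    · rw [← image_line, eb, hq, image_singleton]
    · rw [e1, h1, image_union, image_singleton]
  case c7b =>
    obtain ⟨⟨hL, l, c, hl, hc0, hj⟩, hp⟩ := hc
    refine ⟨⟨by rw [e0]; exact hL.image _, l.comp ψ.toAffineMap, _, linear_comp_ne_zero hl,
      mul_ne_zero (mul_ne_zero (det_linear_ne_zero φ) (det_linear_ne_zero ψ)) hc0, fun p => ?_⟩,
      by rw [e1]; exact hp.image _⟩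
    rw [jac_conj hG h, hj]
    simp only [AffineMap.coe_comp, Function.comp_apply, AffineEquiv.coe_toAffineMap]
    ring
  case' c8a => obtain ⟨hJ, hp⟩ := hc
  case' c8b => obtain ⟨hJ, hp⟩ := hc
  case' c8c => obtain ⟨hJ, hp⟩ := hc
  case c9a => rw [e0, e1]; exact ⟨by rw [hc.1]; simp, hc.2.image _⟩
  case c9b => rw [e0, e1]; exact ⟨by rw [hc.1]; simp, hc.2.image _⟩
  case c9c => rw [e0, e1]; exact ⟨by rw [hc.1]; simp, hc.2.image _⟩
  all_goals
    refine ⟨?_, by rw [e1]; exact hp.image _⟩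
    obtain ⟨hL, l, hl, hj⟩ := hJ
    have hk := mul_ne_zero (det_linear_ne_zero φ) (det_linear_ne_zero ψ)
    refine ⟨by rw [e0]; exact hL.image _,
      (LinearMap.det φ.linear.toLinearMap * LinearMap.det ψ.linear.toLinearMap) •
        l.comp ψ.toAffineMap, ?_, fun p => ?_⟩
    · rw [AffineMap.smul_linear]
      exact smul_ne_zero hk (linear_comp_ne_zero hl)
    · rw [jac_conj hG h, hj]
      simp
end Transport

/-! ### Coordinates: determinants and explicit affine equivalences -/

lemma linearIndependent_pair_of_det {u v : ℝ × ℝ} (h : u.1 * v.2 - u.2 * v.1 ≠ 0) :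
    LinearIndependent ℝ ![u, v] := by
  rw [LinearIndependent.pair_iff]
  intro s t hst
  have h1 := congrArg Prod.fst hst
  have h2 := congrArg Prod.snd hst
  simp only [Prod.fst_add, Prod.smul_fst, Prod.snd_add, Prod.smul_snd, smul_eq_mul, Prod.fst_zero,
    Prod.snd_zero] at h1 h2
  constructor
  · refine (mul_eq_zero.1 (?_ : s * (u.1 * v.2 - u.2 * v.1) = 0)).resolve_right h
    linear_combination v.2 * h1 - v.1 * h2
  · refine (mul_eq_zero.1 (?_ : t * (u.1 * v.2 - u.2 * v.1) = 0)).resolve_right h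
    linear_combination u.1 * h2 - u.2 * h1

/-- The linear automorphism of the plane with matrix `!![a, b; c, d]`. -/
noncomputable def linearEquivOfDet (a b c d : ℝ) (h : a * d - b * c ≠ 0) :
    (ℝ × ℝ) ≃ₗ[ℝ] (ℝ × ℝ) where
  toFun p := (a * p.1 + b * p.2, c * p.1 + d * p.2)
  invFun p := ((d * p.1 - b * p.2) / (a * d - b * c), (a * p.2 - c * p.1) / (a * d - b * c))
  map_add' p q := by ext <;> simp <;> ring
  map_smul' r p := by ext <;> simp <;> ring
  left_inv p := by ext <;> simp <;> rw [div_eq_iff h] <;> ring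
  right_inv p := by
    ext <;> simp only <;> rw [mul_div_assoc', mul_div_assoc', ← add_div, div_eq_iff h] <;> ring

/-- The affine automorphism `(x, y) ↦ (a x + b y + e, c x + d y + f)` of the plane. -/
noncomputable def affineEquivOfDet (a b c d e f : ℝ) (h : a * d - b * c ≠ 0) :
    (ℝ × ℝ) ≃ᵃ[ℝ] (ℝ × ℝ) where
  toEquiv := (linearEquivOfDet a b c d h).toEquiv.trans (Equiv.addRight (e, f))
  linear := linearEquivOfDet a b c d h
  map_vadd' p v := by
    simp [add_assoc]

@[simp]
lemma affineEquivOfDet_apply (a b c d e f : ℝ) (h : a * d - b * c ≠ 0) (p : ℝ × ℝ) :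
    affineEquivOfDet a b c d e f h p = (a * p.1 + b * p.2 + e, c * p.1 + d * p.2 + f) := rfl

/-! ### The Jacobian determinant of a quadratic map -/

lemma jac_prodMk {f g : ℝ × ℝ → ℝ} {f' g' : ℝ × ℝ →L[ℝ] ℝ} {p : ℝ × ℝ} (hf : HasFDerivAt f f' p)
    (hg : HasFDerivAt g g' p) :
    jac (fun q => (f q, g q)) p = f' (1, 0) * g' (0, 1) - f' (0, 1) * g' (1, 0) := by
  rw [jac, (hf.prodMk hg).fderiv, ContinuousLinearMap.det,
    ← LinearMap.det_toMatrix (Module.Basis.finTwoProd ℝ), Matrix.det_fin_two]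
  simp [LinearMap.toMatrix_apply]

lemma jac_quadMap (a b : Fin 6 → ℝ) (p : ℝ × ℝ) :
    jac (quadMap a b) p =
      (2 * a 0 * p.1 + a 1 * p.2 + a 3) * (b 1 * p.1 + 2 * b 2 * p.2 + b 4) -
      (a 1 * p.1 + 2 * a 2 * p.2 + a 4) * (2 * b 0 * p.1 + b 1 * p.2 + b 3) := by
  have key : ∀ a : Fin 6 → ℝ, HasFDerivAt
      (fun p : ℝ × ℝ => a 0 * p.1 ^ 2 + a 1 * p.1 * p.2 + a 2 * p.2 ^ 2 + a 3 * p.1 + a 4 * p.2 + a 5)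
      ((2 * a 0 * p.1 + a 1 * p.2 + a 3) • ContinuousLinearMap.fst ℝ ℝ ℝ +
        (a 1 * p.1 + 2 * a 2 * p.2 + a 4) • ContinuousLinearMap.snd ℝ ℝ ℝ) p := by
    intro a
    have h1 : HasFDerivAt (fun p : ℝ × ℝ => p.1) (ContinuousLinearMap.fst ℝ ℝ ℝ) p := hasFDerivAt_fst
    have h2 : HasFDerivAt (fun p : ℝ × ℝ => p.2) (ContinuousLinearMap.snd ℝ ℝ ℝ) p := hasFDerivAt_snd
    have := (((((h1.pow 2).const_mul (a 0)).add ((h1.const_mul (a 1)).mul h2)).add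
      ((h2.pow 2).const_mul (a 2))).add (h1.const_mul (a 3))).add (h2.const_mul (a 4))
      |>.add_const (a 5)
    refine this.congr_fderiv ?_
    ext <;> simp <;> ring
  unfold quadMap
  rw [jac_prodMk (key a) (key b)]
  simp

lemma jac_of_eq_quadMap {F : ℝ × ℝ → ℝ × ℝ} (a b : Fin 6 → ℝ) (h : ∀ p, F p = quadMap a b p)
    (p : ℝ × ℝ) : jac F p =
      (2 * a 0 * p.1 + a 1 * p.2 + a 3) * (b 1 * p.1 + 2 * b 2 * p.2 + b 4) -
      (a 1 * p.1 + 2 * a 2 * p.2 + a 4) * (2 * b 0 * p.1 + b 1 * p.2 + b 3) := by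
  rw [show F = quadMap a b from funext h, jac_quadMap]

/-! ### A criterion for cusps -/

/-- A critical point of a smooth curve is a cusp if the second and third derivatives there are
linearly independent: the order-three Taylor polynomial is the required normal form, and the
tangent direction near the critical point is governed by the second derivative, with opposite
signs on the two sides. -/
lemma isCuspAt_of_hasDerivAt {γ γ₁ γ₂ : ℝ → ℝ × ℝ} {v : ℝ × ℝ} {t₀ : ℝ} (hγ : ContDiff ℝ ∞ γ)
    (h1 : ∀ t, HasDerivAt γ (γ₁ t) t) (h2 : ∀ t, HasDerivAt γ₁ (γ₂ t) t)
    (h3 : HasDerivAt γ₂ v t₀) (h0 : γ₁ t₀ = 0) (hli : LinearIndependent ℝ ![γ₂ t₀, v]) :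
    IsCuspAt γ t₀ := by
  have e1 : deriv γ = γ₁ := funext fun t => (h1 t).deriv
  have e2 : deriv γ₁ = γ₂ := funext fun t => (h2 t).deriv
  have hne : γ₂ t₀ ≠ 0 := hli.ne_zero 0
  have hslope := (hasDerivAt_iff_tendsto_slope.1 (h2 t₀))
  have hu := (continuousAt_unitVec hne).tendsto.comp hslope
  refine ⟨⟨unitVec (γ₂ t₀), unitVec_ne_zero hne, ?_, ?_⟩, (2⁻¹ : ℝ) • γ₂ t₀, (6⁻¹ : ℝ) • v, ?_, ?_⟩
  · rw [e1]
    refine (hu.mono_left (nhdsWithin_mono _ fun t ht => ne_of_gt ht)).congr' ?_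
    filter_upwards [self_mem_nhdsWithin] with t ht
    rw [Function.comp_apply, slope_def_module, h0, sub_zero,
      unitVec_smul (inv_pos.2 (sub_pos.2 ht))]
  · rw [e1]
    refine ((hu.mono_left (nhdsWithin_mono _ fun t ht => ne_of_lt ht)).neg).congr' ?_
    filter_upwards [self_mem_nhdsWithin] with t ht
    rw [Function.comp_apply, slope_def_module, h0, sub_zero, ← unitVec_neg, ← neg_smul, ← inv_neg,
      neg_sub, unitVec_smul (inv_pos.2 (sub_pos.2 ht))]
  · rw [LinearIndependent.pair_iff] at hli ⊢
    intro s t hst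
    have := hli (s * 2⁻¹) (t * 6⁻¹) (by simpa [smul_smul] using hst)
    simpa using this
  · have hT := taylor_isLittleO_univ (x₀ := t₀) (n := 3) (contDiff_infty.1 hγ 3)
    refine hT.congr_left fun t => ?_
    have d2 : iteratedDeriv 2 γ = γ₂ := by
      rw [iteratedDeriv_succ, iteratedDeriv_one, e1, e2]
    have d3 : iteratedDeriv 3 γ t₀ = v := by
      rw [iteratedDeriv_succ, d2, h3.deriv]
    simp only [taylorWithinEval_succ, taylor_within_zero_eval, iteratedDerivWithin_univ, zero_add,
      d3]
    rw [show (1 : ℕ) + 1 = 2 from rfl, d2, iteratedDeriv_one, e1, h0]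
    simp only [smul_zero, add_zero, smul_smul, sub_sub, add_assoc]
    norm_num [Nat.factorial]
    ring_nf

lemma isEmbedding_of_strictMono_comp {γ : ℝ → ℝ × ℝ} (hγ : Continuous γ) {f : ℝ × ℝ → ℝ}
    (hf : Continuous f) (h : StrictMono (f ∘ γ)) : IsEmbedding γ := by
  refine .of_comp hγ hf (h.isEmbedding_of_ordConnected ?_)
  exact (isPreconnected_range (hf.comp hγ)).ordConnected

/-! ### Normal forms whose critical set is empty, a point, a union of lines, or everything -/

lemma hasForm_c1_model : HasForm (fun p => (p.1 ^ 2 + p.2, p.1)) .c1 := by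
  have hj : ∀ p, jac (fun p => (p.1 ^ 2 + p.2, p.1)) p = -1 := fun p => by
    rw [jac_of_eq_quadMap ![1, 0, 0, 0, 1, 0] ![0, 0, 0, 1, 0, 0] (by intro p; simp [quadMap])]
    simp
  have h0 : J0 (fun p => (p.1 ^ 2 + p.2, p.1)) = ∅ := by
    ext p; simp [J0, hj]
  exact ⟨h0, by rw [J1, h0, image_empty]⟩

lemma hasForm_c2_model : HasForm (fun p => (p.1 ^ 2 - p.2 ^ 2, p.1 * p.2)) .c2 := by
  have hj : ∀ p, jac (fun p => (p.1 ^ 2 - p.2 ^ 2, p.1 * p.2)) p = 2 * (p.1 ^ 2 + p.2 ^ 2) :=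
    fun p => by
    rw [jac_of_eq_quadMap ![1, 0, -1, 0, 0, 0] ![0, 1, 0, 0, 0, 0]
      (by intro p; ext <;> simp [quadMap]; ring)]
    simp; ring
  have h0 : J0 (fun p => (p.1 ^ 2 - p.2 ^ 2, p.1 * p.2)) = {0} := by
    ext p
    simp only [J0, hj, mem_ofPred_eq, mem_singleton_iff]
    constructor
    · intro h
      by_contra hp
      linarith [sq_add_sq_pos hp]
    · rintro rfl; simp
  exact ⟨⟨_, h0⟩, 0, by rw [J1, h0, image_singleton]; simp⟩

lemma hasForm_c5a_model : HasForm (fun p => (p.1 ^ 2, p.2 ^ 2)) .c5a := by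
  have hj : ∀ p, jac (fun p => (p.1 ^ 2, p.2 ^ 2)) p = 4 * (p.1 * p.2) := fun p => by
    rw [jac_of_eq_quadMap ![1, 0, 0, 0, 0, 0] ![0, 0, 1, 0, 0, 0] (by intro p; simp [quadMap])]
    simp; ring
  have h0 : J0 (fun p => (p.1 ^ 2, p.2 ^ 2)) = line 0 (1, 0) ∪ line 0 (0, 1) := by
    ext ⟨x, y⟩
    simp [J0, hj, line, or_comm]
  refine ⟨⟨0, (1, 0), (0, 1), linearIndependent_pair_of_det (by norm_num), h0⟩,
    0, (1, 0), (0, 1), linearIndependent_pair_of_det (by norm_num), ?_⟩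
  rw [J1, h0, image_union]
  congr 1
  · ext ⟨x, y⟩
    constructor
    · rintro ⟨_, ⟨t, rfl⟩, h⟩
      exact ⟨t ^ 2, sq_nonneg t, by simpa using h.symm⟩
    · rintro ⟨t, ht, h⟩
      exact ⟨_, ⟨√t, rfl⟩, by simp [h, Real.sq_sqrt ht]⟩
  · ext ⟨x, y⟩
    constructor
    · rintro ⟨_, ⟨t, rfl⟩, h⟩
      exact ⟨t ^ 2, sq_nonneg t, by simpa using h.symm⟩
    · rintro ⟨t, ht, h⟩
      exact ⟨_, ⟨√t, rfl⟩, by simp [h, Real.sq_sqrt ht]⟩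

lemma hasForm_c5b_model : HasForm (fun p => (p.1 ^ 2 + p.2, p.2 ^ 2)) .c5b := by
  have hj : ∀ p, jac (fun p => (p.1 ^ 2 + p.2, p.2 ^ 2)) p = 4 * (p.1 * p.2) := fun p => by
    rw [jac_of_eq_quadMap ![1, 0, 0, 0, 1, 0] ![0, 0, 1, 0, 0, 0] (by intro p; simp [quadMap])]
    simp; ring
  have h0 : J0 (fun p => (p.1 ^ 2 + p.2, p.2 ^ 2)) = line 0 (1, 0) ∪ line 0 (0, 1) := by
    ext ⟨x, y⟩
    simp [J0, hj, line, or_comm]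
  refine ⟨⟨0, (1, 0), (0, 1), linearIndependent_pair_of_det (by norm_num), h0⟩,
    0, (1, 0), {p | p.2 = p.1 ^ 2}, by simp, ⟨AffineEquiv.refl ℝ _, by simp⟩, ?_, ?_⟩
  · ext ⟨x, y⟩
    simp only [ray, mem_inter_iff, mem_ofPred_eq, mem_singleton_iff]
    constructor
    · rintro ⟨⟨t, ht, h⟩, h2⟩
      simp only [zero_add, Prod.smul_mk, smul_eq_mul, mul_one, mul_zero, Prod.mk.injEq] at h
      have : x = 0 := by
        have h3 : x ^ 2 = 0 := by rw [← h2, h.2]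
        simpa using h3
      simp [this, h.2]
    · intro h
      simp only [Prod.mk_eq_zero] at h
      exact ⟨⟨0, le_rfl, by simp [h.1, h.2]⟩, by simp [h.1, h.2]⟩
  rw [J1, h0, image_union]
  congr 1
  · ext ⟨x, y⟩
    constructor
    · rintro ⟨_, ⟨t, rfl⟩, h⟩
      exact ⟨t ^ 2, sq_nonneg t, by simpa using h.symm⟩
    · rintro ⟨t, ht, h⟩
      exact ⟨_, ⟨√t, rfl⟩, by simp [h, Real.sq_sqrt ht]⟩
  · ext ⟨x, y⟩
    constructor
    · rintro ⟨_, ⟨t, rfl⟩, h⟩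
      simp only [zero_add, Prod.smul_mk, smul_eq_mul, mul_one, mul_zero, Prod.mk.injEq] at h
      simp only [mem_ofPred_eq, ← h.1, ← h.2]
      ring
    · intro h
      simp only [mem_ofPred_eq] at h
      exact ⟨_, ⟨x, rfl⟩, by simp [h]⟩

lemma mem_line_vertical {x a b : ℝ} {p : ℝ × ℝ} : p ∈ line (x, a) (0, b) ↔
    p.1 = x ∧ ∃ t : ℝ, p.2 = a + t * b := by
  obtain ⟨u, v⟩ := p
  simp [line]

lemma hasForm_c7a_model {ε : ℝ} (hε : ε ≠ 0) :
    HasForm (fun p => (1 / 2 * p.1 ^ 2 + ε * p.1, p.1 * p.2 - ε * p.2)) .c7a := by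
  set F : ℝ × ℝ → ℝ × ℝ := fun p => (1 / 2 * p.1 ^ 2 + ε * p.1, p.1 * p.2 - ε * p.2) with hF
  have hj : ∀ p, jac F p = (p.1 + ε) * (p.1 - ε) := fun p => by
    rw [jac_of_eq_quadMap ![1 / 2, 0, 0, ε, 0, 0] ![0, 1, 0, 0, -ε, 0]
      (by intro p; ext <;> simp [quadMap, hF]; ring)]
    simp [-mul_eq_mul_left_iff, -mul_eq_mul_right_iff]
    ring
  have h0 : J0 F = line (-ε, 0) (0, 1) ∪ line (ε, 0) (0, 1) := by
    ext ⟨x, y⟩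
    simp [J0, hj, mem_line_vertical, add_eq_zero_iff_eq_neg, sub_eq_zero]
  have hL : F '' line (-ε, 0) (0, 1) = line (-(1 / 2) * ε ^ 2, 0) (0, -2 * ε) := by
    ext ⟨x, y⟩
    rw [mem_line_vertical]
    constructor
    · rintro ⟨_, ⟨t, rfl⟩, h⟩
      simp only [hF, Prod.smul_mk, Prod.mk_add_mk, smul_eq_mul, Prod.mk.injEq] at h
      exact ⟨by linear_combination -h.1, t, by linear_combination -h.2⟩
    · rintro ⟨hx, t, ht⟩
      refine ⟨_, ⟨t, rfl⟩, ?_⟩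
      simp only [hF, Prod.smul_mk, Prod.mk_add_mk, smul_eq_mul, Prod.mk.injEq]
      exact ⟨by linear_combination -hx, by linear_combination -ht⟩
  have hz : F '' line (ε, 0) (0, 1) = {(3 / 2 * ε ^ 2, 0)} := by
    ext ⟨x, y⟩
    rw [mem_singleton_iff]
    constructor
    · rintro ⟨_, ⟨t, rfl⟩, h⟩
      rw [← h]
      ext <;> simp [hF]; ring
    · intro h
      refine ⟨(ε, 0), ⟨0, by simp⟩, ?_⟩
      rw [h]
      ext <;> simp [hF]; ring
  refine ⟨_, _, _, by simp, ?_, h0, _, _, ?_, ?_, hL, hz, ?_⟩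
  · rw [Set.disjoint_left]
    intro p hp hp'
    rw [mem_line_vertical] at hp hp'
    apply hε
    linarith [hp.1, hp'.1]
  · exact ⟨_, _, by simpa using hε, rfl⟩
  · rw [mem_line_vertical]
    rintro ⟨h, -⟩
    have : 0 < ε ^ 2 := by positivity
    simp only at h
    linarith
  · rw [J1, h0, image_union, hL, hz]

/-- The affine function `(x, y) ↦ k x` has nonzero linear part when `k ≠ 0`. -/
lemma smul_fst_linear_ne_zero {k : ℝ} (hk : k ≠ 0) :
    (k • (LinearMap.fst ℝ ℝ ℝ).toAffineMap).linear ≠ 0 := by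
  intro h
  have := LinearMap.congr_fun h (1, 0)
  simp at this
  exact hk this

lemma J0_eq_of_jac_eq {F : ℝ × ℝ → ℝ × ℝ} {k : ℝ} (hk : k ≠ 0) (hj : ∀ p, jac F p = k * p.1) :
    J0 F = line 0 (0, 1) := by
  ext p
  rw [show (0 : ℝ × ℝ) = (0, 0) from rfl, mem_line_vertical]
  simp [J0, hj, hk]

lemma image_line_vertical (F : ℝ × ℝ → ℝ × ℝ) : F '' line 0 (0, 1) = range fun t => F (0, t) := by
  ext q
  constructor
  · rintro ⟨_, ⟨t, rfl⟩, rfl⟩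
    exact ⟨t, by simp⟩
  · rintro ⟨t, rfl⟩
    exact ⟨(0, t), ⟨t, by simp⟩, rfl⟩

lemma J0IsSimpleLine_of_jac_eq {F : ℝ × ℝ → ℝ × ℝ} {k : ℝ} (hk : k ≠ 0)
    (hj : ∀ p, jac F p = k * p.1) : J0IsSimpleLine F :=
  ⟨⟨_, _, by simp, J0_eq_of_jac_eq hk hj⟩, _, smul_fst_linear_ne_zero hk, fun p => by simp [hj]⟩

lemma hasForm_c7b_model : HasForm (fun p => (1 / 2 * p.1 ^ 2, p.1 * p.2)) .c7b := by
  set F : ℝ × ℝ → ℝ × ℝ := fun p => (1 / 2 * p.1 ^ 2, p.1 * p.2) with hF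
  have hj : ∀ p, jac F p = p.1 ^ 2 := fun p => by
    rw [jac_of_eq_quadMap ![1 / 2, 0, 0, 0, 0, 0] ![0, 1, 0, 0, 0, 0]
      (by intro p; simp [quadMap, hF])]
    simp; ring
  have h0 : J0 F = line 0 (0, 1) := by
    ext p
    rw [show (0 : ℝ × ℝ) = (0, 0) from rfl, mem_line_vertical]
    simp [J0, hj]
  refine ⟨⟨⟨_, _, by simp, h0⟩, (1 : ℝ) • (LinearMap.fst ℝ ℝ ℝ).toAffineMap, 1,
    smul_fst_linear_ne_zero one_ne_zero, one_ne_zero, fun p => by simp [hj]⟩, 0, ?_⟩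
  rw [J1, h0, image_line_vertical]
  simp [hF]

lemma hasForm_c8a_model : HasForm (fun p => (p.1, p.1 * p.2)) .c8a := by
  have hj : ∀ p, jac (fun p => (p.1, p.1 * p.2)) p = 1 * p.1 := fun p => by
    rw [jac_of_eq_quadMap ![0, 0, 0, 1, 0, 0] ![0, 1, 0, 0, 0, 0] (by intro p; simp [quadMap])]
    simp
  refine ⟨J0IsSimpleLine_of_jac_eq one_ne_zero hj, 0, ?_⟩
  rw [J1, J0_eq_of_jac_eq one_ne_zero hj, image_line_vertical]
  simp

lemma hasForm_c8b_model : HasForm (fun p => (p.1 ^ 2, p.2)) .c8b := by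
  have hj : ∀ p, jac (fun p => (p.1 ^ 2, p.2)) p = 2 * p.1 := fun p => by
    rw [jac_of_eq_quadMap ![1, 0, 0, 0, 0, 0] ![0, 0, 0, 0, 1, 0] (by intro p; simp [quadMap])]
    simp
  refine ⟨J0IsSimpleLine_of_jac_eq two_ne_zero hj, 0, (0, 1), by simp, ?_⟩
  rw [J1, J0_eq_of_jac_eq two_ne_zero hj, image_line_vertical]
  ext ⟨x, y⟩
  simp [line, eq_comm]

lemma hasForm_c8c_model {δ : ℝ} (hδ : δ ≠ 0) :
    HasForm (fun p => (p.1 ^ 2 + δ * p.2 ^ 2, p.2)) .c8c := by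
  have hj : ∀ p, jac (fun p => (p.1 ^ 2 + δ * p.2 ^ 2, p.2)) p = 2 * p.1 := fun p => by
    rw [jac_of_eq_quadMap ![1, 0, δ, 0, 0, 0] ![0, 0, 0, 0, 1, 0] (by intro p; simp [quadMap])]
    simp
  refine ⟨J0IsSimpleLine_of_jac_eq two_ne_zero hj,
    affineEquivOfDet 0 δ 1 0 0 0 (by simpa using hδ), ?_⟩
  rw [J1, J0_eq_of_jac_eq two_ne_zero hj, image_line_vertical]
  ext ⟨x, y⟩
  constructor
  · rintro ⟨t, h⟩
    refine ⟨(t, t ^ 2), rfl, ?_⟩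
    simpa using h
  · rintro ⟨⟨t, s⟩, hs, h⟩
    refine ⟨t, ?_⟩
    simp only [mem_ofPred_eq] at hs
    subst hs
    simpa using h

lemma hasForm_c9c_model : HasForm (fun p => (p.1 ^ 2, p.1)) .c9c := by
  have h0 : J0 (fun p => (p.1 ^ 2, p.1)) = univ := by
    ext p
    simp only [J0, mem_ofPred_eq, mem_univ, iff_true]
    rw [jac_of_eq_quadMap ![1, 0, 0, 0, 0, 0] ![0, 0, 0, 1, 0, 0] (by intro p; simp [quadMap])]
    simp
  refine ⟨h0, affineEquivOfDet 0 1 1 0 0 0 (by norm_num), ?_⟩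
  rw [J1, h0]
  ext ⟨x, y⟩
  constructor
  · rintro ⟨p, -, h⟩
    exact ⟨(p.1, p.1 ^ 2), rfl, by simpa using h⟩
  · rintro ⟨⟨t, s⟩, hs, h⟩
    refine ⟨(t, 0), mem_univ _, ?_⟩
    simp only [mem_ofPred_eq] at hs
    subst hs
    simpa using h

lemma J0_eq_univ_of_snd_zero {f : ℝ × ℝ → ℝ} (hf : Differentiable ℝ f) :
    J0 (fun p => (f p, (0 : ℝ))) = univ := by
  ext p
  simp only [J0, mem_ofPred_eq, mem_univ, iff_true]
  rw [jac_prodMk (hf p).hasFDerivAt (hasFDerivAt_const (0 : ℝ) p)]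
  simp

lemma hasForm_c9a_of_surjective {f : ℝ × ℝ → ℝ} (hf : Differentiable ℝ f)
    (hs : Function.Surjective f) : HasForm (fun p => (f p, (0 : ℝ))) .c9a := by
  refine ⟨J0_eq_univ_of_snd_zero hf, 0, (1, 0), by simp, ?_⟩
  rw [J1, J0_eq_univ_of_snd_zero hf]
  ext ⟨x, y⟩
  constructor
  · rintro ⟨p, -, h⟩
    exact ⟨f p, by simpa using h.symm⟩
  · rintro ⟨t, h⟩
    obtain ⟨p, rfl⟩ := hs t
    exact ⟨p, mem_univ _, by simp [h]⟩

lemma hasForm_c9b_of_range {f : ℝ × ℝ → ℝ} (hf : Differentiable ℝ f) (h0 : ∀ p, 0 ≤ f p)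
    (hs : ∀ t, 0 ≤ t → ∃ p, f p = t) : HasForm (fun p => (f p, (0 : ℝ))) .c9b := by
  refine ⟨J0_eq_univ_of_snd_zero hf, 0, (1, 0), by simp, ?_⟩
  rw [J1, J0_eq_univ_of_snd_zero hf]
  ext ⟨x, y⟩
  constructor
  · rintro ⟨p, -, h⟩
    exact ⟨f p, h0 p, by simpa using h.symm⟩
  · rintro ⟨t, ht, h⟩
    obtain ⟨p, rfl⟩ := hs t ht
    exact ⟨p, mem_univ _, by simp [h]⟩

/-! ### The parabola with a cuspidal image -/

lemma hasForm_c6_model : HasForm (fun p => (1 / 2 * p.1 ^ 2 + p.2, p.1 * p.2)) .c6 := by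
  set F : ℝ × ℝ → ℝ × ℝ := fun p => (1 / 2 * p.1 ^ 2 + p.2, p.1 * p.2) with hF
  have hj : ∀ p, jac F p = p.1 ^ 2 - p.2 := fun p => by
    rw [jac_of_eq_quadMap ![1 / 2, 0, 0, 0, 1, 0] ![0, 1, 0, 0, 0, 0]
      (by intro p; simp [quadMap, hF])]
    simp; ring
  have h0 : J0 F = {p | p.2 = p.1 ^ 2} := by
    ext p
    simp [J0, hj, sub_eq_zero, eq_comm]
  have h1 : ∀ t : ℝ, HasDerivAt (fun t : ℝ => (3 / 2 * t ^ 2, t ^ 3)) (3 * t, 3 * t ^ 2) t := by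
    intro t
    refine HasDerivAt.prodMk ?_ ?_
    · exact (((hasDerivAt_id t).pow 2).const_mul (3 / 2)).congr_deriv (by simp; ring)
    · exact ((hasDerivAt_id t).pow 3).congr_deriv (by simp)
  have h2 : ∀ t : ℝ, HasDerivAt (fun t : ℝ => (3 * t, 3 * t ^ 2)) (3, 6 * t) t := by
    intro t
    refine HasDerivAt.prodMk ?_ ?_
    · exact ((hasDerivAt_id t).const_mul 3).congr_deriv (by simp)
    · exact (((hasDerivAt_id t).pow 2).const_mul 3).congr_deriv (by simp; ring)
  have h3 : HasDerivAt (fun t : ℝ => ((3 : ℝ), 6 * t)) (0, 6) 0 := by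
    refine HasDerivAt.prodMk (hasDerivAt_const _ _) ?_
    exact ((hasDerivAt_id (0 : ℝ)).const_mul 6).congr_deriv (by simp)
  have hsm : ContDiff ℝ ∞ fun t : ℝ => (3 / 2 * t ^ 2, t ^ 3) := by fun_prop
  refine ⟨⟨AffineEquiv.refl ℝ _, by simp [h0]⟩, fun t => (3 / 2 * t ^ 2, t ^ 3), hsm, ?_, ?_, 0,
    isCuspAt_of_hasDerivAt hsm h1 h2 h3 (by simp) (linearIndependent_pair_of_det (by norm_num)), ?_⟩
  · refine isEmbedding_of_strictMono_comp hsm.continuous continuous_snd ?_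
    exact Odd.strictMono_pow (n := 3) (by decide)
  · rw [J1, h0]
    ext q
    constructor
    · rintro ⟨t, rfl⟩
      refine ⟨(t, t ^ 2), rfl, ?_⟩
      simp only [hF, Prod.mk.injEq]
      exact ⟨by ring, by ring⟩
    · rintro ⟨⟨x, y⟩, hp, rfl⟩
      simp only [mem_ofPred_eq] at hp
      subst hp
      refine ⟨x, ?_⟩
      simp only [hF, Prod.mk.injEq]
      exact ⟨by ring, by ring⟩
  · intro t ht h
    rw [(h1 t).deriv] at h
    simp [ht] at h

/-! ### The hyperbola -/

lemma hasDerivAt_exp_mul (k t : ℝ) :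
    HasDerivAt (fun s => Real.exp (k * s)) (k * Real.exp (k * t)) t := by
  have := ((hasDerivAt_id t).const_mul k).exp
  simpa [mul_comm] using this

/-- Exponential parametrizations of the images of the two branches (`k = 1` and `k = -1`) of the
hyperbola `x y = 1` under `(x, y) ↦ (x ^ 2 + 2 y, y ^ 2 + 2 x)`. -/
noncomputable def expCurve (k : ℝ) (s : ℝ) : ℝ × ℝ :=
  (Real.exp (2 * s) + 2 * k * Real.exp (-1 * s), Real.exp (-2 * s) + 2 * k * Real.exp (1 * s))

lemma hasDerivAt_expCurve (k t : ℝ) : HasDerivAt (expCurve k)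
    (2 * Real.exp (2 * t) - 2 * k * Real.exp (-1 * t),
      -2 * Real.exp (-2 * t) + 2 * k * Real.exp (1 * t)) t := by
  refine HasDerivAt.prodMk ?_ ?_
  · exact ((hasDerivAt_exp_mul 2 t).add ((hasDerivAt_exp_mul (-1) t).const_mul (2 * k))).congr_deriv
      (by ring)
  · exact ((hasDerivAt_exp_mul (-2) t).add ((hasDerivAt_exp_mul 1 t).const_mul (2 * k))).congr_deriv
      (by ring)

lemma contDiff_expCurve (k : ℝ) : ContDiff ℝ ∞ (expCurve k) := by
  unfold expCurve; fun_prop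

/-- The difference of the coordinates increases along the cuspidal branch, although both
coordinates have a minimum at the cusp. -/
lemma strictMono_expCurve_one : StrictMono ((fun p : ℝ × ℝ => p.1 - p.2) ∘ expCurve 1) := by
  have hd : ∀ t, HasDerivAt ((fun p : ℝ × ℝ => p.1 - p.2) ∘ expCurve 1)
      (2 * Real.exp (-2 * t) * ((Real.exp t - 1) ^ 2 * (Real.exp t ^ 2 + Real.exp t + 1))) t := by
    intro t
    have h := hasDerivAt_expCurve 1 t
    have hfst : HasDerivAt (fun s => (expCurve 1 s).1) _ t := h.fst
    have hsnd : HasDerivAt (fun s => (expCurve 1 s).2) _ t := h.snd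
    refine (hfst.sub hsnd).congr_deriv ?_
    have e1 : Real.exp (2 * t) = Real.exp t ^ 2 := by rw [← Real.exp_nat_mul]; norm_num
    have e2 : Real.exp (-2 * t) = (Real.exp t ^ 2)⁻¹ := by rw [← e1, ← Real.exp_neg]; ring_nf
    have e3 : Real.exp (-1 * t) = (Real.exp t)⁻¹ := by rw [← Real.exp_neg]; ring_nf
    have h0 := (Real.exp_pos t).ne'
    simp only [e1, e2, e3, one_mul]
    field_simp
    ring
  have hpos : ∀ t, t ≠ 0 → 0 < deriv ((fun p : ℝ × ℝ => p.1 - p.2) ∘ expCurve 1) t := by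
    intro t ht
    rw [(hd t).deriv]
    have : Real.exp t - 1 ≠ 0 := by simpa [sub_eq_zero] using ht
    positivity
  have hc : Continuous ((fun p : ℝ × ℝ => p.1 - p.2) ∘ expCurve 1) :=
    continuous_iff_continuousAt.2 fun t => (hd t).continuousAt
  refine StrictMonoOn.Iic_union_Ici (a := 0) ?_ ?_
  · refine strictMonoOn_of_deriv_pos (convex_Iic 0) hc.continuousOn fun t ht => hpos t ?_
    rw [interior_Iic] at ht
    exact ne_of_lt ht
  · refine strictMonoOn_of_deriv_pos (convex_Ici 0) hc.continuousOn fun t ht => hpos t ?_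
    rw [interior_Ici] at ht
    exact ne_of_gt ht

lemma isCuspAt_expCurve_one : IsCuspAt (expCurve 1) 0 := by
  have h2 : ∀ t, HasDerivAt (fun t => (2 * Real.exp (2 * t) - 2 * 1 * Real.exp (-1 * t),
      -2 * Real.exp (-2 * t) + 2 * 1 * Real.exp (1 * t)))
      (4 * Real.exp (2 * t) + 2 * Real.exp (-1 * t),
      4 * Real.exp (-2 * t) + 2 * Real.exp (1 * t)) t := by
    intro t
    refine HasDerivAt.prodMk ?_ ?_
    · exact (((hasDerivAt_exp_mul 2 t).const_mul 2).sub
        ((hasDerivAt_exp_mul (-1) t).const_mul (2 * 1))).congr_deriv (by ring)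
    · exact (((hasDerivAt_exp_mul (-2) t).const_mul (-2)).add
        ((hasDerivAt_exp_mul 1 t).const_mul (2 * 1))).congr_deriv (by ring)
  have h3 : HasDerivAt (fun t => (4 * Real.exp (2 * t) + 2 * Real.exp (-1 * t),
      4 * Real.exp (-2 * t) + 2 * Real.exp (1 * t))) (6, -6) 0 := by
    refine HasDerivAt.prodMk ?_ ?_
    · exact (((hasDerivAt_exp_mul 2 0).const_mul 4).add
        ((hasDerivAt_exp_mul (-1) 0).const_mul 2)).congr_deriv (by norm_num)
    · exact (((hasDerivAt_exp_mul (-2) 0).const_mul 4).add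
        ((hasDerivAt_exp_mul 1 0).const_mul 2)).congr_deriv (by norm_num)
  exact isCuspAt_of_hasDerivAt (contDiff_expCurve 1) (hasDerivAt_expCurve 1) h2 h3 (by simp)
    (linearIndependent_pair_of_det (by norm_num))

lemma range_expCurve {k : ℝ} (hk : k ^ 2 = 1) :
    range (expCurve k) = (fun p : ℝ × ℝ => (p.1 ^ 2 + 2 * p.2, p.2 ^ 2 + 2 * p.1)) ''
      {p | p.1 * p.2 = 1 ∧ 0 < k * p.1} := by
  have e (t : ℝ) : expCurve k t = (fun p : ℝ × ℝ => (p.1 ^ 2 + 2 * p.2, p.2 ^ 2 + 2 * p.1))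
      (k * Real.exp t, k * Real.exp (-t)) := by
    have e1 : Real.exp (2 * t) = Real.exp t ^ 2 := by rw [← Real.exp_nat_mul]; norm_num
    have e2 : Real.exp (-2 * t) = Real.exp (-t) ^ 2 := by rw [← Real.exp_nat_mul]; norm_num
    simp only [expCurve, e1, e2, mul_pow, hk]
    simp [mul_assoc]
  ext q
  constructor
  · rintro ⟨t, rfl⟩
    refine ⟨(k * Real.exp t, k * Real.exp (-t)), ⟨?_, ?_⟩, (e t).symm⟩
    · have := Real.exp_add t (-t)
      simp only [add_neg_cancel, Real.exp_zero] at this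
      linear_combination (Real.exp t * Real.exp (-t)) * hk - this
    · have := Real.exp_pos t
      simp only
      nlinarith
  · rintro ⟨⟨x, y⟩, ⟨hxy, hx⟩, rfl⟩
    simp only at hxy hx
    have hy : y = k * (k * x)⁻¹ := by
      rw [eq_mul_inv_iff_mul_eq₀ hx.ne']
      linear_combination k * hxy
    refine ⟨Real.log (k * x), ?_⟩
    rw [e, Real.exp_neg, Real.exp_log hx, ← hy, ← mul_assoc, ← sq, hk, one_mul]

lemma hasForm_c4_model : HasForm (fun p => (p.1 ^ 2 + 2 * p.2, p.2 ^ 2 + 2 * p.1)) .c4 := by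
  set F : ℝ × ℝ → ℝ × ℝ := fun p => (p.1 ^ 2 + 2 * p.2, p.2 ^ 2 + 2 * p.1) with hF
  have hj : ∀ p, jac F p = 4 * (p.1 * p.2 - 1) := fun p => by
    rw [jac_of_eq_quadMap ![1, 0, 0, 0, 2, 0] ![0, 0, 1, 2, 0, 0]
      (by intro p; simp [quadMap, hF])]
    simp; ring
  have hneg : {p : ℝ × ℝ | p.1 * p.2 = 1 ∧ 0 < -1 * p.1} =
      {p : ℝ × ℝ | p.1 * p.2 = 1 ∧ p.1 < 0} := by
    ext p; simp
  have hpos : {p : ℝ × ℝ | p.1 * p.2 = 1 ∧ 0 < 1 * p.1} =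
      {p : ℝ × ℝ | p.1 * p.2 = 1 ∧ 0 < p.1} := by
    ext p; simp
  have r1 := range_expCurve (k := 1) (by norm_num)
  have r2 := range_expCurve (k := -1) (by norm_num)
  rw [hpos] at r1
  rw [hneg] at r2
  have h0 : J0 F = {p | p.1 * p.2 = 1 ∧ p.1 < 0} ∪ {p | p.1 * p.2 = 1 ∧ 0 < p.1} := by
    ext p
    simp only [J0, hj, mem_ofPred_eq, mem_union, ← and_or_left, mul_eq_zero, sub_eq_zero,
      OfNat.ofNat_ne_zero, false_or]
    refine ⟨fun h => ⟨h, lt_or_gt_of_ne fun h1 => ?_⟩, And.left⟩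
    rw [h1] at h
    simp at h
  refine ⟨{p | p.1 * p.2 = 1 ∧ p.1 < 0}, {p | p.1 * p.2 = 1 ∧ 0 < p.1},
    ⟨affineEquivOfDet (-1) 0 0 (-1) 0 0 (by norm_num), ?_, ?_⟩, h0, ?_, ?_, ?_, ?_⟩
  · ext ⟨x, y⟩
    constructor
    · rintro ⟨h1, h2⟩
      exact ⟨(-x, -y), ⟨by simpa using h1, by simpa using h2⟩, by simp⟩
    · rintro ⟨⟨u, v⟩, ⟨h1, h2⟩, h⟩
      simp at h h1 h2
      exact ⟨by simpa [← h.1, ← h.2] using h1, by simpa [← h.1] using h2⟩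
  · ext ⟨x, y⟩
    constructor
    · rintro ⟨h1, h2⟩
      exact ⟨(-x, -y), ⟨by simpa using h1, by simpa using h2⟩, by simp⟩
    · rintro ⟨⟨u, v⟩, ⟨h1, h2⟩, h⟩
      simp at h h1 h2
      exact ⟨by simpa [← h.1, ← h.2] using h1, by simpa [← h.1] using h2⟩
  · rw [← r2]
    have hd : ∀ t, HasDerivAt (fun s => (expCurve (-1) s).1) _ t :=
      fun t => (hasDerivAt_expCurve (-1) t).fst
    have hp : ∀ t, 0 < 2 * Real.exp (2 * t) - 2 * (-1) * Real.exp (-1 * t) := fun t => by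
      have := Real.exp_pos (2 * t); have := Real.exp_pos (-1 * t); linarith
    refine ⟨expCurve (-1), contDiff_expCurve _, ?_, rfl, fun t h => ?_⟩
    · refine isEmbedding_of_strictMono_comp (contDiff_expCurve _).continuous continuous_fst ?_
      exact strictMono_of_hasDerivAt_pos hd hp
    · rw [(hasDerivAt_expCurve _ t).deriv] at h
      exact (hp t).ne' (congrArg Prod.fst h)
  · rw [← r1]
    refine ⟨expCurve 1, contDiff_expCurve _, ?_, rfl, 0, isCuspAt_expCurve_one, fun t ht h => ?_⟩
    · exact isEmbedding_of_strictMono_comp (contDiff_expCurve _).continuous (by fun_prop)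
        strictMono_expCurve_one
    · rw [(hasDerivAt_expCurve _ t).deriv] at h
      have h1 := congrArg Prod.fst h
      simp only [Prod.fst_zero] at h1
      have : Real.exp (2 * t) = Real.exp (-1 * t) := by linarith
      rw [Real.exp_eq_exp] at this
      exact ht (by linarith)
  · rw [Set.disjoint_left]
    rintro _ ⟨⟨u, v⟩, ⟨huv, hu⟩, rfl⟩ ⟨⟨x, y⟩, ⟨hxy, hx⟩, h⟩
    simp only [hF, Prod.mk.injEq] at h huv hu hxy hx
    have hv : v < 0 := by
      by_contra hv
      nlinarith
    have hy : 0 < y := by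
      by_contra hy
      nlinarith
    -- `(x - u) (x + u) = -2 (y - v)` and `(y - v) (y + v) = -2 (x - u)` with `x - u, y - v > 0`
    have h1 : x + u < 0 := by
      by_contra hc
      nlinarith [mul_nonneg (by linarith : 0 ≤ x - u) (not_lt.1 hc)]
    have h2 : y + v < 0 := by
      by_contra hc
      nlinarith [mul_nonneg (by linarith : 0 ≤ y - v) (not_lt.1 hc)]
    nlinarith
  · rw [J1, h0, image_union]

/-! ### The circle and the deltoid -/

lemma hasDerivAt_cos_sq_sub_sin_sq (t : ℝ) :
    HasDerivAt (fun t => Real.cos t ^ 2 - Real.sin t ^ 2) (-4 * (Real.cos t * Real.sin t)) t :=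
  (((Real.hasDerivAt_cos t).pow 2).sub ((Real.hasDerivAt_sin t).pow 2)).congr_deriv
    (by simp; ring)

lemma hasDerivAt_cos_mul_sin (t : ℝ) :
    HasDerivAt (fun t => Real.cos t * Real.sin t) (Real.cos t ^ 2 - Real.sin t ^ 2) t :=
  ((Real.hasDerivAt_cos t).mul (Real.hasDerivAt_sin t)).congr_deriv (by ring)

/-- The deltoid, the image of the unit circle under `z ↦ z ^ 2 + 2 * conj z`. -/
noncomputable def deltoid (t : ℝ) : ℝ × ℝ :=
  (Real.cos t ^ 2 - Real.sin t ^ 2 + 2 * Real.cos t,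
    2 * (Real.cos t * Real.sin t) - 2 * Real.sin t)

lemma contDiff_deltoid : ContDiff ℝ ∞ deltoid := by
  unfold deltoid; fun_prop

lemma hasDerivAt_deltoid (t : ℝ) : HasDerivAt deltoid
    (-4 * (Real.cos t * Real.sin t) - 2 * Real.sin t,
      2 * (Real.cos t ^ 2 - Real.sin t ^ 2) - 2 * Real.cos t) t := by
  refine HasDerivAt.prodMk ?_ ?_
  · exact ((hasDerivAt_cos_sq_sub_sin_sq t).add
      ((Real.hasDerivAt_cos t).const_mul 2)).congr_deriv (by ring)
  · exact (((hasDerivAt_cos_mul_sin t).const_mul 2).sub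
      ((Real.hasDerivAt_sin t).const_mul 2)).congr_deriv (by ring)

lemma isCuspAt_deltoid {t : ℝ} (h1 : Real.sin t * (2 * Real.cos t + 1) = 0)
    (h2 : Real.cos t ^ 2 - Real.sin t ^ 2 = Real.cos t) : IsCuspAt deltoid t := by
  have d2 : ∀ t, HasDerivAt (fun t => (-4 * (Real.cos t * Real.sin t) - 2 * Real.sin t,
      2 * (Real.cos t ^ 2 - Real.sin t ^ 2) - 2 * Real.cos t))
      (-4 * (Real.cos t ^ 2 - Real.sin t ^ 2) - 2 * Real.cos t,
        -8 * (Real.cos t * Real.sin t) + 2 * Real.sin t) t := by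
    intro t
    refine HasDerivAt.prodMk ?_ ?_
    · exact (((hasDerivAt_cos_mul_sin t).const_mul (-4)).sub
        ((Real.hasDerivAt_sin t).const_mul 2)).congr_deriv (by ring)
    · exact (((hasDerivAt_cos_sq_sub_sin_sq t).const_mul 2).sub
        ((Real.hasDerivAt_cos t).const_mul 2)).congr_deriv (by ring)
  have d3 : HasDerivAt (fun t => (-4 * (Real.cos t ^ 2 - Real.sin t ^ 2) - 2 * Real.cos t,
      -8 * (Real.cos t * Real.sin t) + 2 * Real.sin t))
      (16 * (Real.cos t * Real.sin t) + 2 * Real.sin t,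
        -8 * (Real.cos t ^ 2 - Real.sin t ^ 2) + 2 * Real.cos t) t := by
    refine HasDerivAt.prodMk ?_ ?_
    · exact (((hasDerivAt_cos_sq_sub_sin_sq t).const_mul (-4)).sub
        ((Real.hasDerivAt_cos t).const_mul 2)).congr_deriv (by ring)
    · exact (((hasDerivAt_cos_mul_sin t).const_mul (-8)).add
        ((Real.hasDerivAt_sin t).const_mul 2)).congr_deriv (by ring)
  have h1' : Real.cos t * Real.sin t = -Real.sin t / 2 := by linear_combination h1 / 2
  refine isCuspAt_of_hasDerivAt contDiff_deltoid hasDerivAt_deltoid d2 d3 ?_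
    (linearIndependent_pair_of_det ?_)
  · rw [h1', h2]
    ext <;> simp
    ring
  · simp only [h1', h2]
    have := Real.sin_sq_add_cos_sq t
    have h36 : (-4 * Real.cos t - 2 * Real.cos t) * (-8 * Real.cos t + 2 * Real.cos t) -
        (-8 * (-Real.sin t / 2) + 2 * Real.sin t) * (16 * (-Real.sin t / 2) + 2 * Real.sin t) = 36 := by
      linear_combination 36 * this
    rw [h36]
    norm_num

/-- On the unit circle `z ↦ z ^ 2 + 2 * conj z` is injective: if `z ≠ w` have the same image then
`z w (z + w) = 2`, so `|z + w| = 2`, which is impossible for distinct points of the circle. -/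
lemma eq_of_sq_add_two_conj_eq {x y u v : ℝ} (hz : x ^ 2 + y ^ 2 = 1) (hw : u ^ 2 + v ^ 2 = 1)
    (h1 : x ^ 2 - y ^ 2 + 2 * x = u ^ 2 - v ^ 2 + 2 * u)
    (h2 : 2 * (x * y) - 2 * y = 2 * (u * v) - 2 * v) : x = u ∧ y = v := by
  have hz' : Complex.normSq ⟨x, y⟩ = 1 := by rw [Complex.normSq_mk]; linarith
  have hw' : Complex.normSq ⟨u, v⟩ = 1 := by rw [Complex.normSq_mk]; linarith
  have key : ((⟨x, y⟩ : ℂ) - ⟨u, v⟩) * (⟨x, y⟩ * ⟨u, v⟩ * (⟨x, y⟩ + ⟨u, v⟩) - 2) = 0 := by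
    have hzc := Complex.mul_conj (⟨x, y⟩ : ℂ)
    have hwc := Complex.mul_conj (⟨u, v⟩ : ℂ)
    rw [hz'] at hzc
    rw [hw'] at hwc
    have he : (⟨x, y⟩ : ℂ) ^ 2 + 2 * (starRingEnd ℂ) ⟨x, y⟩ =
        ⟨u, v⟩ ^ 2 + 2 * (starRingEnd ℂ) ⟨u, v⟩ := by
      apply Complex.ext <;> simp [sq] <;> linarith
    push_cast at hzc hwc
    linear_combination (⟨x, y⟩ * ⟨u, v⟩ : ℂ) * he - 2 * (⟨u, v⟩ : ℂ) * hzc + 2 * (⟨x, y⟩ : ℂ) * hwc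
  rcases mul_eq_zero.1 key with h | h
  · have := sub_eq_zero.1 h
    exact ⟨congrArg Complex.re this, congrArg Complex.im this⟩
  · have h4 : Complex.normSq (⟨x, y⟩ + ⟨u, v⟩) = 4 := by
      have := congrArg Complex.normSq (sub_eq_zero.1 h)
      rw [map_mul, map_mul, hz', hw'] at this
      rw [one_mul, one_mul] at this
      rw [this]
      norm_num
    rw [Complex.normSq_apply] at h4
    simp only [Complex.add_re, Complex.add_im] at h4
    have h5 : (x - u) ^ 2 + (y - v) ^ 2 = 0 := by nlinarith
    constructor
    · nlinarith [sq_nonneg (x - u), sq_nonneg (y - v)]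
    · nlinarith [sq_nonneg (x - u), sq_nonneg (y - v)]

lemma injOn_deltoid : InjOn deltoid (Ico 0 (2 * Real.pi)) := by
  intro s hs t ht h
  obtain ⟨h1, h2⟩ := Prod.mk.inj h
  obtain ⟨hc, hsn⟩ := eq_of_sq_add_two_conj_eq (Real.cos_sq_add_sin_sq s)
    (Real.cos_sq_add_sin_sq t) h1 h2
  have h3 : Real.cos (s - t) = 1 := by
    rw [Real.cos_sub, hc, hsn]
    linear_combination Real.cos_sq_add_sin_sq t
  have := (Real.cos_eq_one_iff_of_lt_of_lt (by linarith [hs.1, ht.2]) (by linarith [hs.2, ht.1])).1 h3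
  linarith

lemma cos_two_pi_div_three : Real.cos (2 * Real.pi / 3) = -1 / 2 := by
  rw [show 2 * Real.pi / 3 = Real.pi - Real.pi / 3 by ring, Real.cos_pi_sub, Real.cos_pi_div_three]
  norm_num

lemma eq_of_cos_eq_neg_half {t : ℝ} (ht : t ∈ Ico 0 (2 * Real.pi)) (h : Real.cos t = -1 / 2) :
    t = 2 * Real.pi / 3 ∨ t = 4 * Real.pi / 3 := by
  have hpi := Real.pi_pos
  rw [← cos_two_pi_div_three] at h
  rcases le_total t Real.pi with hle | hle
  · left
    exact Real.injOn_cos ⟨ht.1, hle⟩ ⟨by linarith, by linarith⟩ h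
  · right
    rw [← Real.cos_two_pi_sub] at h
    have := Real.injOn_cos ⟨by linarith [ht.2], by linarith⟩ ⟨by linarith, by linarith⟩ h
    linarith

lemma isThreeCuspClosedCurve_range_deltoid : IsThreeCuspClosedCurve (range deltoid) := by
  have hpi := Real.pi_pos
  refine ⟨deltoid, contDiff_deltoid, fun t => by simp [deltoid], injOn_deltoid, rfl,
    {0, 2 * Real.pi / 3, 4 * Real.pi / 3}, ?_, ?_, ?_, ?_⟩
  · rw [Finset.card_eq_three]
    exact ⟨_, _, _, by linarith, by linarith, by intro h; linarith, rfl⟩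
  · intro t ht
    simp only [Finset.coe_insert, Finset.coe_singleton, mem_insert_iff, mem_singleton_iff] at ht
    rcases ht with rfl | rfl | rfl <;> constructor <;> linarith
  · have half : ∀ t, Real.cos t = -1 / 2 → IsCuspAt deltoid t := fun t ht => by
      refine isCuspAt_deltoid (by rw [ht]; ring) ?_
      have := Real.sin_sq_add_cos_sq t
      rw [ht] at this ⊢
      linarith
    intro t ht
    simp only [Finset.mem_insert, Finset.mem_singleton] at ht
    rcases ht with rfl | rfl | rfl
    · exact isCuspAt_deltoid (by simp) (by simp)
    · exact half _ cos_two_pi_div_three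
    · refine half _ ?_
      rw [← Real.cos_two_pi_sub, ← cos_two_pi_div_three]
      ring_nf
  · intro t ht htc h
    rw [(hasDerivAt_deltoid t).deriv] at h
    obtain ⟨h1, h2⟩ := Prod.mk.inj h
    apply htc
    simp only [Finset.mem_insert, Finset.mem_singleton]
    have h3 : Real.sin t * (2 * Real.cos t + 1) = 0 := by linear_combination -h1 / 2
    have h4 := Real.sin_sq_add_cos_sq t
    rcases mul_eq_zero.1 h3 with hs | hc
    · left
      rw [hs] at h2 h4
      have : Real.cos t = 1 := by linarith
      exact (Real.cos_eq_one_iff_of_lt_of_lt (by linarith [ht.1]) ht.2).1 this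
    · right
      exact eq_of_cos_eq_neg_half ht (by linarith)

lemma hasForm_c3_model :
    HasForm (fun p => (p.1 ^ 2 - p.2 ^ 2 + 2 * p.1, 2 * p.1 * p.2 - 2 * p.2)) .c3 := by
  set F : ℝ × ℝ → ℝ × ℝ := fun p => (p.1 ^ 2 - p.2 ^ 2 + 2 * p.1, 2 * p.1 * p.2 - 2 * p.2) with hF
  have hj : ∀ p, jac F p = 4 * (p.1 ^ 2 + p.2 ^ 2 - 1) := fun p => by
    rw [jac_of_eq_quadMap ![1, 0, -1, 2, 0, 0] ![0, 2, 0, 0, -2, 0]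
      (by intro p; simp [quadMap, hF]; constructor <;> ring)]
    simp; ring
  have h0 : J0 F = {p | p.1 ^ 2 + p.2 ^ 2 = 1} := by
    ext p
    simp [J0, hj, sub_eq_zero]
  refine ⟨⟨AffineEquiv.refl ℝ _, by simp [h0]⟩, ?_⟩
  have h1 : J1 F = range deltoid := by
    rw [J1, h0]
    ext q
    constructor
    · rintro ⟨⟨x, y⟩, hp, rfl⟩
      simp only [mem_ofPred_eq] at hp
      have hn : ‖(⟨x, y⟩ : ℂ)‖ = 1 := by
        rw [Complex.norm_def, Complex.normSq_mk, Real.sqrt_eq_one]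
        linarith
      have hz : (⟨x, y⟩ : ℂ) ≠ 0 := by
        rw [← norm_ne_zero_iff, hn]
        exact one_ne_zero
      refine ⟨Complex.arg ⟨x, y⟩, ?_⟩
      simp only [deltoid, Complex.cos_arg hz, Complex.sin_arg, hn, hF, div_one]
      ext <;> ring
    · rintro ⟨t, rfl⟩
      refine ⟨(Real.cos t, Real.sin t), Real.cos_sq_add_sin_sq t, ?_⟩
      simp only [hF, deltoid, Prod.mk.injEq, true_and]
      ring
  rw [h1]
  exact isThreeCuspClosedCurve_range_deltoid

/-! ### Reduction of quadratic maps to normal forms -/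

/-- The pair (critical set, critical image) of `F` occurs in the list of forms. -/
def IsClassified (F : ℝ × ℝ → ℝ × ℝ) : Prop := ∃ c, HasForm F c

lemma IsClassified.conj {F G : ℝ × ℝ → ℝ × ℝ} (hc : IsClassified G) (hG : Differentiable ℝ G)
    (φ ψ : (ℝ × ℝ) ≃ᵃ[ℝ] (ℝ × ℝ)) (h : ∀ p, F p = φ (G (ψ p))) : IsClassified F :=
  hc.imp fun _ hc => hc.conj hG h

/-- The quadratic forms `a₀ x² + a₁ x y + a₂ y²` and `b₀ x² + b₁ x y + b₂ y²` are the leading parts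
of classified maps only, whatever the terms of degree at most one. -/
def IsClassifiedPencil (a₀ a₁ a₂ b₀ b₁ b₂ : ℝ) : Prop :=
  ∀ a₃ a₄ a₅ b₃ b₄ b₅ : ℝ, IsClassified fun p =>
    (a₀ * p.1 ^ 2 + a₁ * p.1 * p.2 + a₂ * p.2 ^ 2 + a₃ * p.1 + a₄ * p.2 + a₅,
     b₀ * p.1 ^ 2 + b₁ * p.1 * p.2 + b₂ * p.2 ^ 2 + b₃ * p.1 + b₄ * p.2 + b₅)

section Moves

variable {a₀ a₁ a₂ b₀ b₁ b₂ : ℝ}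

lemma IsClassifiedPencil.target (α β γ δ : ℝ) (hd : α * δ - β * γ ≠ 0)
    (h : IsClassifiedPencil (α * a₀ + β * b₀) (α * a₁ + β * b₁) (α * a₂ + β * b₂)
      (γ * a₀ + δ * b₀) (γ * a₁ + δ * b₁) (γ * a₂ + δ * b₂)) :
    IsClassifiedPencil a₀ a₁ a₂ b₀ b₁ b₂ := by
  intro a₃ a₄ a₅ b₃ b₄ b₅
  refine (h (α * a₃ + β * b₃) (α * a₄ + β * b₄) (α * a₅ + β * b₅)
    (γ * a₃ + δ * b₃) (γ * a₄ + δ * b₄) (γ * a₅ + δ * b₅)).conj (by fun_prop)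
    (affineEquivOfDet α β γ δ 0 0 hd).symm (.refl ℝ _) fun p => ?_
  rw [← AffineEquiv.apply_eq_iff_eq (affineEquivOfDet α β γ δ 0 0 hd),
    AffineEquiv.apply_symm_apply]
  simp only [affineEquivOfDet_apply, AffineEquiv.refl_apply, Prod.mk.injEq]
  constructor <;> ring

lemma IsClassifiedPencil.source (α β γ δ : ℝ) (hd : α * δ - β * γ ≠ 0)
    (h : IsClassifiedPencil
      (a₀ * α ^ 2 + a₁ * (α * γ) + a₂ * γ ^ 2)
      (2 * a₀ * (α * β) + a₁ * (α * δ + β * γ) + 2 * a₂ * (γ * δ))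
      (a₀ * β ^ 2 + a₁ * (β * δ) + a₂ * δ ^ 2)
      (b₀ * α ^ 2 + b₁ * (α * γ) + b₂ * γ ^ 2)
      (2 * b₀ * (α * β) + b₁ * (α * δ + β * γ) + 2 * b₂ * (γ * δ))
      (b₀ * β ^ 2 + b₁ * (β * δ) + b₂ * δ ^ 2)) :
    IsClassifiedPencil a₀ a₁ a₂ b₀ b₁ b₂ := by
  intro a₃ a₄ a₅ b₃ b₄ b₅
  refine (h (a₃ * α + a₄ * γ) (a₃ * β + a₄ * δ) a₅ (b₃ * α + b₄ * γ) (b₃ * β + b₄ * δ) b₅).conj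
    (by fun_prop) (.refl ℝ _) (affineEquivOfDet α β γ δ 0 0 hd).symm fun p => ?_
  obtain ⟨q, rfl⟩ := (affineEquivOfDet α β γ δ 0 0 hd).surjective p
  rw [AffineEquiv.symm_apply_apply]
  simp only [affineEquivOfDet_apply, AffineEquiv.refl_apply, Prod.mk.injEq]
  constructor <;> ring

lemma IsClassifiedPencil.swap_target (h : IsClassifiedPencil b₀ b₁ b₂ a₀ a₁ a₂) :
    IsClassifiedPencil a₀ a₁ a₂ b₀ b₁ b₂ := by
  refine .target 0 1 1 0 (by norm_num) ?_
  simpa using h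

lemma IsClassifiedPencil.swap_source (h : IsClassifiedPencil a₂ a₁ a₀ b₂ b₁ b₀) :
    IsClassifiedPencil a₀ a₁ a₂ b₀ b₁ b₂ := by
  refine .source 0 1 1 0 (by norm_num) ?_
  simpa using h

end Moves

/-! ### Leading parts spanning a line -/

lemma isClassifiedPencil_sum_sq {δ : ℝ} (hδ : δ ≠ 0) : IsClassifiedPencil 1 0 δ 0 0 0 := by
  intro a₃ a₄ a₅ b₃ b₄ b₅
  -- completing squares leaves `(x² + δ y², b₃ x + b₄ y)`
  suffices h : IsClassified fun p : ℝ × ℝ => (p.1 ^ 2 + δ * p.2 ^ 2, b₃ * p.1 + b₄ * p.2) by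
    refine h.conj (by fun_prop)
      (affineEquivOfDet 1 0 0 1 (a₅ - a₃ ^ 2 / 4 - a₄ ^ 2 / (4 * δ))
        (b₅ - b₃ * (a₃ / 2) - b₄ * (a₄ / (2 * δ))) (by norm_num))
      (affineEquivOfDet 1 0 0 1 (a₃ / 2) (a₄ / (2 * δ)) (by norm_num)) fun p => ?_
    simp only [affineEquivOfDet_apply, Prod.mk.injEq]
    constructor <;> field_simp <;> ring
  by_cases hN : δ * b₃ ^ 2 + b₄ ^ 2 = 0
  · by_cases hb : b₃ = 0
    · have hb4 : b₄ = 0 := by simpa [hb] using hN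
      simp only [hb, hb4, zero_mul, add_zero]
      rcases lt_or_gt_of_ne hδ with h | h
      · refine ⟨_, hasForm_c9a_of_surjective (by fun_prop) fun t => ?_⟩
        rcases le_total 0 t with ht | ht
        · exact ⟨(√t, 0), by simp [Real.sq_sqrt ht]⟩
        · refine ⟨(0, √(t / δ)), ?_⟩
          simp only [Real.sq_sqrt (div_nonneg_of_nonpos ht h.le)]
          field_simp
          ring
      · refine ⟨_, hasForm_c9b_of_range (by fun_prop) (fun p => by positivity) fun t ht => ?_⟩
        exact ⟨(√t, 0), by simp [Real.sq_sqrt ht]⟩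
    · have hb4 : b₄ ≠ 0 := by
        rintro rfl
        exact mul_ne_zero hδ (pow_ne_zero 2 hb) (by simpa using hN)
      -- the linear form `b₃ x + b₄ y` divides `x² + δ y²`
      have hd : δ = -b₄ ^ 2 / b₃ ^ 2 := by
        field_simp
        linarith
      refine IsClassified.conj ⟨_, hasForm_c8a_model⟩ (by fun_prop)
        (affineEquivOfDet 0 (1 / b₃ ^ 2) 1 0 0 0 (by simpa using hb))
        (affineEquivOfDet b₃ b₄ b₃ (-b₄) 0 0
          (by rw [show b₃ * -b₄ - b₄ * b₃ = -2 * (b₃ * b₄) by ring]; simp [hb, hb4])) fun p => ?_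
      simp only [affineEquivOfDet_apply, Prod.mk.injEq, hd]
      constructor <;> field_simp <;> ring
  · -- `N (x² + δ y²) = (b₄ x - δ b₃ y)² + δ (b₃ x + b₄ y)²` for `N = δ b₃² + b₄²`
    refine IsClassified.conj ⟨_, hasForm_c8c_model hδ⟩ (by fun_prop)
      (affineEquivOfDet (1 / (δ * b₃ ^ 2 + b₄ ^ 2)) 0 0 1 0 0 (by simpa using hN))
      (affineEquivOfDet b₄ (-δ * b₃) b₃ b₄ 0 0
        (by convert hN using 1; ring)) fun p => ?_
    simp only [affineEquivOfDet_apply, Prod.mk.injEq]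
    constructor
    · field_simp
      ring
    · ring

lemma isClassifiedPencil_sq : IsClassifiedPencil 1 0 0 0 0 0 := by
  intro a₃ a₄ a₅ b₃ b₄ b₅
  by_cases hb4 : b₄ = 0
  · subst hb4
    by_cases ha4 : a₄ = 0
    · subst ha4
      by_cases hb3 : b₃ = 0
      · subst hb3
        refine IsClassified.conj ⟨_, hasForm_c9b_of_range (f := fun p => p.1 ^ 2) (by fun_prop)
          (fun p => sq_nonneg _) fun t ht => ⟨(√t, 0), Real.sq_sqrt ht⟩⟩ (by fun_prop)
          (affineEquivOfDet 1 0 0 1 (a₅ - a₃ ^ 2 / 4) b₅ (by norm_num))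
          (affineEquivOfDet 1 0 0 1 (a₃ / 2) 0 (by norm_num)) fun p => ?_
        simp only [affineEquivOfDet_apply, Prod.mk.injEq]
        constructor <;> ring
      · refine IsClassified.conj ⟨_, hasForm_c9c_model⟩ (by fun_prop)
          (affineEquivOfDet 1 a₃ 0 b₃ a₅ b₅ (by simpa using hb3)) (.refl ℝ _) fun p => ?_
        simp only [affineEquivOfDet_apply, AffineEquiv.refl_apply, Prod.mk.injEq]
        constructor <;> ring
    · by_cases hb3 : b₃ = 0
      · subst hb3
        refine IsClassified.conj ⟨_, hasForm_c9a_of_surjective (f := fun p => p.1 ^ 2 + a₄ * p.2)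
          (by fun_prop) fun t => ⟨(0, t / a₄), by field_simp; ring⟩⟩ (by fun_prop)
          (affineEquivOfDet 1 0 0 1 (a₅ - a₃ ^ 2 / 4) b₅ (by norm_num))
          (affineEquivOfDet 1 0 0 1 (a₃ / 2) 0 (by norm_num)) fun p => ?_
        simp only [affineEquivOfDet_apply, Prod.mk.injEq]
        constructor <;> ring
      · refine IsClassified.conj ⟨_, hasForm_c1_model⟩ (by fun_prop)
          (affineEquivOfDet 1 0 0 b₃ a₅ b₅ (by simpa using hb3))
          (affineEquivOfDet 1 0 a₃ a₄ 0 0 (by simpa using ha4)) fun p => ?_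
        simp only [affineEquivOfDet_apply, Prod.mk.injEq]
        constructor <;> ring
  · refine IsClassified.conj ⟨_, hasForm_c8b_model⟩ (by fun_prop)
      (affineEquivOfDet 1 (a₄ / b₄) 0 1
        (a₅ - (a₃ - a₄ * b₃ / b₄) ^ 2 / 4 - a₄ * b₅ / b₄) 0 (by norm_num))
      (affineEquivOfDet 1 0 b₃ b₄ ((a₃ - a₄ * b₃ / b₄) / 2) b₅ (by simpa using hb4)) fun p => ?_
    simp only [affineEquivOfDet_apply, Prod.mk.injEq]
    constructor <;> field_simp <;> ring

lemma isClassifiedPencil_zero_of_ne {a₀ a₁ a₂ : ℝ} (h : a₀ ≠ 0) :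
    IsClassifiedPencil a₀ a₁ a₂ 0 0 0 := by
  refine .target (1 / a₀) 0 0 1 (by simpa using h) ?_
  refine .source 1 (-a₁ / (2 * a₀)) 0 1 (by norm_num) ?_
  have key : IsClassifiedPencil 1 0 ((4 * a₀ * a₂ - a₁ ^ 2) / (4 * a₀ ^ 2)) 0 0 0 := by
    by_cases hδ : (4 * a₀ * a₂ - a₁ ^ 2) / (4 * a₀ ^ 2) = 0
    · rw [hδ]; exact isClassifiedPencil_sq
    · exact isClassifiedPencil_sum_sq hδ
  convert key using 1 <;> field_simp <;> ring

lemma isClassifiedPencil_zero {a₀ a₁ a₂ : ℝ} (h : a₀ ≠ 0 ∨ a₁ ≠ 0 ∨ a₂ ≠ 0) :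
    IsClassifiedPencil a₀ a₁ a₂ 0 0 0 := by
  by_cases h0 : a₀ = 0
  · by_cases h2 : a₂ = 0
    · have h1 : a₁ ≠ 0 := by simpa [h0, h2] using h
      refine .source 1 0 1 1 (by norm_num) ?_
      have := isClassifiedPencil_zero_of_ne (a₁ := a₁) (a₂ := 0) h1
      convert this using 1 <;> simp [h0, h2]
    · exact .swap_source (isClassifiedPencil_zero_of_ne h2)
  · exact isClassifiedPencil_zero_of_ne h0

/-! ### Leading parts spanning a plane -/

lemma exists_cube_eq (c : ℝ) : ∃ x : ℝ, x ^ 3 = c := by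
  rcases le_total 0 c with hc | hc
  · exact ⟨_, Real.rpow_inv_natCast_pow hc three_ne_zero⟩
  · refine ⟨-((-c) ^ ((3 : ℕ) : ℝ)⁻¹), ?_⟩
    rw [Odd.neg_pow (by decide), Real.rpow_inv_natCast_pow (neg_nonneg.2 hc) three_ne_zero, neg_neg]

lemma isClassified_two_squares (A B : ℝ) :
    IsClassified fun p : ℝ × ℝ => (p.1 ^ 2 + A * p.2, p.2 ^ 2 + B * p.1) := by
  by_cases hA : A = 0
  · by_cases hB : B = 0
    · subst hA hB
      exact ⟨.c5a, by simpa using hasForm_c5a_model⟩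
    · subst hA
      refine IsClassified.conj ⟨_, hasForm_c5b_model⟩ (by fun_prop)
        (affineEquivOfDet 0 (1 / B ^ 2) 1 0 0 0 (by simpa using hB))
        (affineEquivOfDet 0 1 B 0 0 0 (by simpa using hB)) fun p => ?_
      simp only [affineEquivOfDet_apply, Prod.mk.injEq]
      constructor
      · field_simp
        ring
      · ring
  · by_cases hB : B = 0
    · subst hB
      refine IsClassified.conj ⟨_, hasForm_c5b_model⟩ (by fun_prop)
        (affineEquivOfDet 1 0 0 (1 / A ^ 2) 0 0 (by simpa using hA))
        (affineEquivOfDet 1 0 0 A 0 0 (by simpa using hA)) fun p => ?_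
      simp only [affineEquivOfDet_apply, Prod.mk.injEq]
      constructor
      · ring
      · field_simp
        ring
    · -- rescaling `x` by `r` and `y` by `A r² / 2` turns both linear coefficients into `2`
      obtain ⟨r, hr⟩ := exists_cube_eq (8 / (A ^ 2 * B))
      have hr0 : r ≠ 0 := by
        rintro rfl
        have : 8 / (A ^ 2 * B) ≠ 0 := by positivity
        exact this (by rw [← hr]; norm_num)
      have hB' : B = 8 / (A ^ 2 * r ^ 3) := by
        rw [hr]
        field_simp
      refine IsClassified.conj ⟨_, hasForm_c4_model⟩ (by fun_prop)
        (affineEquivOfDet (1 / r ^ 2) 0 0 (1 / (A * r ^ 2 / 2) ^ 2) 0 0 (by simp [hr0, hA]))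
        (affineEquivOfDet r 0 0 (A * r ^ 2 / 2) 0 0 (by simp [hr0, hA])) fun p => ?_
      simp only [affineEquivOfDet_apply, Prod.mk.injEq]
      constructor
      · field_simp
        ring
      · rw [hB']
        field_simp
        ring

lemma isClassifiedPencil_two_squares : IsClassifiedPencil 1 0 0 0 0 1 := by
  intro a₃ a₄ a₅ b₃ b₄ b₅
  refine (isClassified_two_squares a₄ b₃).conj (by fun_prop)
    (affineEquivOfDet 1 0 0 1 (a₅ - a₃ ^ 2 / 4 - a₄ * b₄ / 2)
      (b₅ - b₄ ^ 2 / 4 - b₃ * a₃ / 2) (by norm_num))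
    (affineEquivOfDet 1 0 0 1 (a₃ / 2) (b₄ / 2) (by norm_num)) fun p => ?_
  simp only [affineEquivOfDet_apply, Prod.mk.injEq]
  constructor <;> ring

/-- In complex notation: a number `c ≠ 0` such that the substitution `z = w / c` turns
`z ^ 2 + β * conj z` into a multiple of `w ^ 2 + 2 * conj w`. -/
lemma exists_mul_sq_eq_two_conj {β : ℂ} (hβ : β ≠ 0) :
    ∃ c : ℂ, c ≠ 0 ∧ β * c ^ 2 = 2 * (starRingEnd ℂ) c := by
  obtain ⟨d, hd⟩ := IsAlgClosed.exists_pow_nat_eq ((starRingEnd ℂ) β) (n := 3) (by norm_num)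
  have hd0 : d ≠ 0 := by
    rintro rfl
    apply hβ
    simpa using hd.symm
  have hβn := Complex.mul_conj β
  have hdn := Complex.mul_conj d
  have hβ0 : (Complex.normSq β : ℂ) ≠ 0 := by simpa using hβ
  refine ⟨((2 * Complex.normSq d / Complex.normSq β : ℝ) : ℂ) * d, ?_, ?_⟩
  · simp [hd0, hβ]
  · rw [map_mul, Complex.conj_ofReal]
    have hs : ((2 * Complex.normSq d / Complex.normSq β : ℝ) : ℂ) * Complex.normSq β =
        2 * Complex.normSq d := by
      push_cast
      field_simp
    set s := ((2 * Complex.normSq d / Complex.normSq β : ℝ) : ℂ)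
    apply mul_right_cancel₀ hd0
    linear_combination β * s ^ 2 * hd + s ^ 2 * hβn + s * hs - 2 * s * hdn

lemma isClassified_complex (p q : ℝ) : IsClassified fun z : ℝ × ℝ =>
    (z.1 ^ 2 - z.2 ^ 2 + p * z.1 + q * z.2, z.1 * z.2 + (q * z.1 - p * z.2) / 2) := by
  by_cases h0 : (⟨p, q⟩ : ℂ) = 0
  · have hp : p = 0 := congrArg Complex.re h0
    have hq : q = 0 := congrArg Complex.im h0
    subst hp hq
    exact ⟨.c2, by simpa using hasForm_c2_model⟩
  · obtain ⟨⟨m, n⟩, hc0, hc⟩ := exists_mul_sq_eq_two_conj h0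
    have h1 := congrArg Complex.re hc
    have h2 := congrArg Complex.im hc
    simp [sq] at h1 h2
    have hmn : 0 < m ^ 2 + n ^ 2 := by
      have := Complex.normSq_pos.2 hc0
      rw [Complex.normSq_mk] at this
      linarith
    refine IsClassified.conj ⟨_, hasForm_c3_model⟩ (by fun_prop)
      (affineEquivOfDet ((m ^ 2 - n ^ 2) / (m ^ 2 + n ^ 2) ^ 2) (2 * m * n / (m ^ 2 + n ^ 2) ^ 2)
        (-(m * n) / (m ^ 2 + n ^ 2) ^ 2) ((m ^ 2 - n ^ 2) / (m ^ 2 + n ^ 2) ^ 2 / 2) 0 0 ?_)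
      (affineEquivOfDet m (-n) n m 0 0 (by nlinarith)) fun z => ?_
    · rw [show (m ^ 2 - n ^ 2) / (m ^ 2 + n ^ 2) ^ 2 * ((m ^ 2 - n ^ 2) / (m ^ 2 + n ^ 2) ^ 2 / 2) -
        2 * m * n / (m ^ 2 + n ^ 2) ^ 2 * (-(m * n) / (m ^ 2 + n ^ 2) ^ 2) =
        1 / (2 * (m ^ 2 + n ^ 2) ^ 2) by field_simp; ring]
      positivity
    · obtain ⟨x, y⟩ := z
      have h1' : p * (m ^ 2 - n ^ 2) - q * (2 * m * n) - 2 * m = 0 := by linear_combination h1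
      have h2' : q * (m ^ 2 - n ^ 2) + p * (2 * m * n) + 2 * n = 0 := by linear_combination h2
      simp only [affineEquivOfDet_apply, Prod.mk.injEq]
      constructor
      · field_simp
        linear_combination ((m ^ 2 - n ^ 2) * x - 2 * m * n * y) * h1' +
          ((m ^ 2 - n ^ 2) * y + 2 * m * n * x) * h2'
      · field_simp
        linear_combination ((m ^ 2 - n ^ 2) * x - 2 * m * n * y) * h2' -
          ((m ^ 2 - n ^ 2) * y + 2 * m * n * x) * h1'

lemma isClassifiedPencil_complex : IsClassifiedPencil 1 0 (-1) 0 1 0 := by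
  intro a₃ a₄ a₅ b₃ b₄ b₅
  refine (isClassified_complex (a₃ / 2 - b₄) (a₄ / 2 + b₃)).conj (by fun_prop)
    (affineEquivOfDet 1 0 0 1
      (a₅ - ((a₃ + 2 * b₄) ^ 2 / 16 - (a₄ - 2 * b₃) ^ 2 / 16 +
        (a₃ / 2 - b₄) * (a₃ + 2 * b₄) / 4 - (a₄ / 2 + b₃) * (a₄ - 2 * b₃) / 4))
      (b₅ - (-(a₃ + 2 * b₄) * (a₄ - 2 * b₃) / 16 +
        ((a₄ / 2 + b₃) * (a₃ + 2 * b₄) / 4 + (a₃ / 2 - b₄) * (a₄ - 2 * b₃) / 4) / 2))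
      (by norm_num))
    (affineEquivOfDet 1 0 0 1 ((a₃ + 2 * b₄) / 4) (-(a₄ - 2 * b₃) / 4) (by norm_num)) fun p => ?_
  simp only [affineEquivOfDet_apply, Prod.mk.injEq]
  constructor <;> ring

lemma isClassified_sq_mul (A B : ℝ) :
    IsClassified fun p : ℝ × ℝ => (p.1 ^ 2 + A * p.1 + B * p.2, p.1 * p.2) := by
  by_cases hB : B = 0
  · subst hB
    by_cases hA : A = 0
    · subst hA
      refine IsClassified.conj ⟨_, hasForm_c7b_model⟩ (by fun_prop)
        (affineEquivOfDet 2 0 0 1 0 0 (by norm_num)) (.refl ℝ _) fun p => ?_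
      simp only [affineEquivOfDet_apply, AffineEquiv.refl_apply, Prod.mk.injEq]
      constructor <;> ring
    · refine IsClassified.conj ⟨_, hasForm_c7a_model (ε := A / 4) (by simpa using hA)⟩ (by fun_prop)
        (affineEquivOfDet 2 0 0 1 (-3 * (A / 4) ^ 2) 0 (by norm_num))
        (affineEquivOfDet 1 0 0 1 (A / 4) 0 (by norm_num)) fun p => ?_
      simp only [affineEquivOfDet_apply, Prod.mk.injEq]
      constructor <;> ring
  · refine IsClassified.conj ⟨_, hasForm_c6_model⟩ (by fun_prop)
      (affineEquivOfDet 2 0 (-2 * A / (3 * B)) (2 / B) (-A ^ 2 / 3) (A ^ 3 / (27 * B))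
        (by simpa using hB))
      (affineEquivOfDet 1 0 (A / 6) (B / 2) (A / 3) (A ^ 2 / 9) (by simpa using hB)) fun p => ?_
    simp only [affineEquivOfDet_apply, Prod.mk.injEq]
    constructor <;> field_simp <;> ring

lemma isClassifiedPencil_sq_mul : IsClassifiedPencil 1 0 0 0 1 0 := by
  intro a₃ a₄ a₅ b₃ b₄ b₅
  refine (isClassified_sq_mul (a₃ - 2 * b₄) a₄).conj (by fun_prop)
    (affineEquivOfDet 1 0 0 1 (a₅ + b₄ ^ 2 - a₃ * b₄ - a₄ * b₃) (b₅ - b₃ * b₄) (by norm_num))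
    (affineEquivOfDet 1 0 0 1 b₄ b₃ (by norm_num)) fun p => ?_
  simp only [affineEquivOfDet_apply, Prod.mk.injEq]
  constructor <;> ring

lemma isClassifiedPencil_diag_mul {α β : ℝ} : IsClassifiedPencil α 0 β 0 1 0 := by
  by_cases hα : α = 0
  · by_cases hβ : β = 0
    · subst hα hβ
      exact .swap_target (isClassifiedPencil_zero (by norm_num))
    · subst hα
      refine .swap_source (.target (1 / β) 0 0 1 (by simpa using hβ) ?_)
      simpa [hβ] using isClassifiedPencil_sq_mul
  · refine .target (1 / α) 0 0 1 (by simpa using hα) ?_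
    suffices h : ∀ b : ℝ, IsClassifiedPencil 1 0 b 0 1 0 by
      convert h (β / α) using 1 <;> field_simp <;> ring
    intro b
    rcases lt_trichotomy b 0 with hb | rfl | hb
    · have hs : √(-b) ≠ 0 := (Real.sqrt_pos.2 (by linarith)).ne'
      have hs2 : √(-b) ^ 2 = -b := Real.sq_sqrt (by linarith)
      refine .source 1 0 0 (1 / √(-b)) (by simpa using hs) (.target 1 0 0 √(-b) (by simpa using hs) ?_)
      convert isClassifiedPencil_complex using 1
      all_goals field_simp
      all_goals simp [hs2]
    · exact isClassifiedPencil_sq_mul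
    · have hs : √b ≠ 0 := (Real.sqrt_pos.2 hb).ne'
      have hs2 : √b ^ 2 = b := Real.sq_sqrt hb.le
      refine .source (1 / 2) (1 / 2) (1 / (2 * √b)) (-1 / (2 * √b)) ?_
        (.target 1 (2 * √b) 1 (-2 * √b) ?_ ?_)
      · field_simp
        norm_num
        exact hs
      · rw [show 1 * (-2 * √b) - 2 * √b * 1 = -4 * √b by ring]
        simpa using hs
      convert isClassifiedPencil_two_squares using 1
      all_goals field_simp
      all_goals rw [hs2]
      all_goals linarith

lemma isClassifiedPencil_mul_sq {β γ : ℝ} : IsClassifiedPencil 0 β γ 1 0 0 := by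
  by_cases hγ : γ = 0
  · by_cases hβ : β = 0
    · subst hγ hβ
      exact .swap_target (isClassifiedPencil_zero (by norm_num))
    · subst hγ
      refine .swap_target (.target 1 0 0 (1 / β) (by simpa using hβ) ?_)
      simpa [hβ] using isClassifiedPencil_sq_mul
  · refine .source 1 0 (-β / (2 * γ)) 1 (by norm_num) ?_
    refine .target 0 1 (1 / γ) (β ^ 2 / (4 * γ ^ 2)) (by simpa using hγ) ?_
    convert isClassifiedPencil_two_squares using 1
    all_goals field_simp
    all_goals ring

/-- The case where the second leading form vanishes on the `x`-axis, hence is `y` times a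
linear form. -/
lemma isClassifiedPencil_of_isotropic {a₀ a₁ a₂ b₁ b₂ : ℝ}
    (h : a₀ ≠ 0 ∨ a₁ ≠ 0 ∨ a₂ ≠ 0 ∨ b₁ ≠ 0 ∨ b₂ ≠ 0) : IsClassifiedPencil a₀ a₁ a₂ 0 b₁ b₂ := by
  by_cases hb1 : b₁ = 0
  · subst hb1
    by_cases hb2 : b₂ = 0
    · subst hb2
      exact isClassifiedPencil_zero (by simpa using h)
    · refine .swap_source (.target 1 (-a₂ / b₂) 0 (1 / b₂) (by simpa using hb2) ?_)
      convert isClassifiedPencil_mul_sq (β := a₁) (γ := a₀) using 1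
      all_goals field_simp
      all_goals ring
  · refine .source (1 / b₁) (-b₂ / b₁) 0 1 (by simpa using hb1) ?_
    refine .target 1 (2 * a₀ * b₂ / b₁ ^ 2 - a₁ / b₁) 0 1 (by norm_num) ?_
    convert isClassifiedPencil_diag_mul (α := a₀ / b₁ ^ 2)
      (β := a₀ * b₂ ^ 2 / b₁ ^ 2 - a₁ * b₂ / b₁ + a₂) using 1
    all_goals field_simp
    all_goals ring

lemma isClassifiedPencil_of_ne_zero {a₀ a₁ a₂ b₀ b₁ b₂ : ℝ}
    (h : a₀ ≠ 0 ∨ a₁ ≠ 0 ∨ a₂ ≠ 0 ∨ b₀ ≠ 0 ∨ b₁ ≠ 0 ∨ b₂ ≠ 0) :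
    IsClassifiedPencil a₀ a₁ a₂ b₀ b₁ b₂ := by
  by_cases ha : a₀ = 0
  · subst ha
    refine .swap_target (isClassifiedPencil_of_isotropic ?_)
    tauto
  · refine .target 1 0 (-b₀ / a₀) 1 (by norm_num) ?_
    convert isClassifiedPencil_of_isotropic (a₀ := a₀) (a₁ := a₁) (a₂ := a₂)
      (b₁ := b₁ - b₀ / a₀ * a₁) (b₂ := b₂ - b₀ / a₀ * a₂) (.inl ha) using 1
    all_goals field_simp
    all_goals ring

/-- Every quadratic map of the plane has one of the listed forms. -/
lemma IsQuadraticMap.exists_hasForm {F : ℝ × ℝ → ℝ × ℝ} (hF : IsQuadraticMap F) :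
    ∃ c, HasForm F c := by
  obtain ⟨a, b, h, rfl⟩ := hF
  exact isClassifiedPencil_of_ne_zero h _ _ _ _ _ _

/-! ### Affine invariants separating the shapes -/

/-- The shapes of the critical sets and critical images that have to be told apart. -/
inductive Shape
  | line | plane | crossingLines | parallelLines | empty | point | ray | ellipse | parabola
  | hyperbola

/-- The set `S` contains a full affine line. -/
def ContainsLine (S : Set (ℝ × ℝ)) : Prop := ∃ p v, v ≠ 0 ∧ line p v ⊆ S

open Classical in
/-- The shape of a plane set, computed from affine invariants (containing a line, being collinear,
connected, compact, a single point). The value is meaningful for the shapes in the list of cases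
only; for these it is computed by the lemmas named `shapeOf_eq`, and by `shapeOf_empty`, `shapeOf_univ` and
`shapeOf_parallelLines`. -/
noncomputable def shapeOf (S : Set (ℝ × ℝ)) : Shape :=
  if ContainsLine S then
    if Collinear ℝ S then .line
    else if ¬IsPreconnected S then .parallelLines
    else if S = univ then .plane
    else .crossingLines
  else if Collinear ℝ S then
    if S = ∅ then .empty
    else if S.Subsingleton then .point
    else .ray
  else if IsCompact S then .ellipse
  else if IsPreconnected S then .parabola
  else .hyperbola

lemma ContainsLine.image {S : Set (ℝ × ℝ)} (h : ContainsLine S) (φ : (ℝ × ℝ) ≃ᵃ[ℝ] (ℝ × ℝ)) :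
    ContainsLine (φ '' S) := by
  obtain ⟨p, v, hv, hS⟩ := h
  exact ⟨_, _, linear_ne_zero φ hv, by rw [← image_line]; exact image_mono hS⟩

lemma symm_image_image (φ : (ℝ × ℝ) ≃ᵃ[ℝ] (ℝ × ℝ)) (S : Set (ℝ × ℝ)) :
    φ.symm '' (φ '' S) = S := by
  simp [image_image]

lemma containsLine_image {S : Set (ℝ × ℝ)} (φ : (ℝ × ℝ) ≃ᵃ[ℝ] (ℝ × ℝ)) :
    ContainsLine (φ '' S) ↔ ContainsLine S :=
  ⟨fun h => by simpa only [symm_image_image] using h.image φ.symm, fun h => h.image φ⟩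

lemma _root_.Collinear.image_affineEquiv {S : Set (ℝ × ℝ)} (h : Collinear ℝ S)
    (φ : (ℝ × ℝ) ≃ᵃ[ℝ] (ℝ × ℝ)) : Collinear ℝ (φ '' S) := by
  rw [collinear_iff_exists_forall_eq_smul_vadd] at h ⊢
  obtain ⟨p, v, h⟩ := h
  refine ⟨φ p, φ.linear v, ?_⟩
  rintro _ ⟨q, hq, rfl⟩
  obtain ⟨t, rfl⟩ := h q hq
  exact ⟨t, by rw [φ.map_vadd, map_smul]⟩

lemma collinear_image {S : Set (ℝ × ℝ)} (φ : (ℝ × ℝ) ≃ᵃ[ℝ] (ℝ × ℝ)) :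
    Collinear ℝ (φ '' S) ↔ Collinear ℝ S :=
  ⟨fun h => by simpa only [symm_image_image] using h.image_affineEquiv φ.symm,
    fun h => h.image_affineEquiv φ⟩

lemma shapeOf_image (φ : (ℝ × ℝ) ≃ᵃ[ℝ] (ℝ × ℝ)) (S : Set (ℝ × ℝ)) :
    shapeOf (φ '' S) = shapeOf S := by
  have h1 : φ '' S = univ ↔ S = univ := by
    have hu : φ '' univ = univ := image_univ_of_surjective φ.surjective
    exact ⟨fun h => φ.injective.image_injective (h.trans hu.symm), fun h => by rw [h, hu]⟩
  have h2 : (φ '' S).Subsingleton ↔ S.Subsingleton :=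
    ⟨fun h => subsingleton_of_image φ.injective S h, fun h => h.image φ⟩
  unfold shapeOf
  rw [propext (containsLine_image φ), propext (collinear_image φ), propext h2,
    ← propext (isEmbedding_affineEquiv φ).isCompact_iff,
    propext (isEmbedding_affineEquiv φ).isInducing.isPreconnected_image]
  simp only [h1, image_eq_empty]

lemma mem_line_self (p v : ℝ × ℝ) : p ∈ line p v := ⟨0, by simp⟩

lemma add_mem_line (p v : ℝ × ℝ) : p + v ∈ line p v := ⟨1, by simp⟩

lemma ContainsLine.not_subsingleton {S : Set (ℝ × ℝ)} (h : ContainsLine S) : ¬S.Subsingleton := by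
  obtain ⟨p, v, hv, hS⟩ := h
  intro hs
  have := hs (hS (mem_line_self p v)) (hS (add_mem_line p v))
  simp [hv] at this

lemma collinear_line (p v : ℝ × ℝ) : Collinear ℝ (line p v) := by
  rw [collinear_iff_exists_forall_eq_smul_vadd]
  refine ⟨p, v, ?_⟩
  rintro _ ⟨t, rfl⟩
  exact ⟨t, by simp [add_comm]⟩

lemma ray_subset_line (p v : ℝ × ℝ) : ray p v ⊆ line p v := by
  rintro _ ⟨t, -, rfl⟩
  exact ⟨t, rfl⟩

lemma not_collinear_of_mem {S : Set (ℝ × ℝ)} {p q r : ℝ × ℝ} (hp : p ∈ S) (hq : q ∈ S) (hr : r ∈ S)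
    (h : (q.1 - p.1) * (r.2 - p.2) - (q.2 - p.2) * (r.1 - p.1) ≠ 0) : ¬Collinear ℝ S := by
  rw [collinear_iff_of_mem hp]
  rintro ⟨v, hv⟩
  obtain ⟨s, rfl⟩ := hv q hq
  obtain ⟨t, rfl⟩ := hv r hr
  apply h
  simp
  ring

lemma isPreconnected_line (p v : ℝ × ℝ) : IsPreconnected (line p v) := by
  have : line p v = range fun t : ℝ => p + t • v := by
    ext q
    simp [line, eq_comm]
  rw [this]
  exact isPreconnected_range (by fun_prop)

lemma det_ne_zero_of_linearIndependent {u v : ℝ × ℝ} (h : LinearIndependent ℝ ![u, v]) :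
    u.1 * v.2 - u.2 * v.1 ≠ 0 := by
  intro hd
  have hu : u ≠ 0 := h.ne_zero 0
  rw [LinearIndependent.pair_iff] at h
  have h1 := h v.2 (-u.2) (by ext <;> simp <;> linarith)
  have h2 := h v.1 (-u.1) (by ext <;> simp <;> linarith)
  exact hu (Prod.ext (by simpa using h2.2) (by simpa using h1.2))

lemma det_eq_zero_of_mem_line {p v q : ℝ × ℝ} (h : q ∈ line p v) :
    v.1 * (q.2 - p.2) - v.2 * (q.1 - p.1) = 0 := by
  obtain ⟨t, rfl⟩ := h
  simp
  ring

lemma mem_line_of_det_eq_zero {p v q : ℝ × ℝ} (hv : v ≠ 0)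
    (h : v.1 * (q.2 - p.2) - v.2 * (q.1 - p.1) = 0) : q ∈ line p v := by
  have hn := (sq_add_sq_pos hv).ne'
  refine ⟨(v.1 * (q.1 - p.1) + v.2 * (q.2 - p.2)) / (v.1 ^ 2 + v.2 ^ 2), ?_⟩
  ext <;> simp
  · field_simp
    linear_combination -v.2 * h
  · field_simp
    linear_combination v.1 * h

lemma IsPoint.shapeOf_eq {S : Set (ℝ × ℝ)} (h : IsPoint S) : shapeOf S = .point := by
  obtain ⟨p, rfl⟩ := h
  have h1 : ¬ContainsLine {p} := fun h => h.not_subsingleton subsingleton_singleton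
  simp [shapeOf, h1, collinear_singleton]

lemma shapeOf_empty : shapeOf ∅ = .empty := by
  have h1 : ¬ContainsLine ∅ := fun h => h.not_subsingleton subsingleton_empty
  simp [shapeOf, h1, collinear_empty]

lemma IsLine.shapeOf_eq {S : Set (ℝ × ℝ)} (h : IsLine S) : shapeOf S = .line := by
  obtain ⟨p, v, hv, rfl⟩ := h
  have h1 : ContainsLine (line p v) := ⟨p, v, hv, Subset.rfl⟩
  simp [shapeOf, h1, collinear_line]

lemma IsRay.shapeOf_eq {S : Set (ℝ × ℝ)} (h : IsRay S) : shapeOf S = .ray := by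
  obtain ⟨p, v, hv, rfl⟩ := h
  have hp : p ∈ ray p v := ⟨0, le_rfl, by simp⟩
  have hpv : p + v ∈ ray p v := ⟨1, zero_le_one, by simp⟩
  have h1 : ¬ContainsLine (ray p v) := by
    rintro ⟨a, w, hw, hS⟩
    have hn := sq_add_sq_pos hv
    -- the scalar product with `v` is bounded below on the ray, hence constant on the line
    have key : ∀ t : ℝ, ∃ s : ℝ, 0 ≤ s ∧ a + t • w = p + s • v ∧
        (a.1 - p.1) * v.1 + (a.2 - p.2) * v.2 + t * (w.1 * v.1 + w.2 * v.2) =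
          s * (v.1 ^ 2 + v.2 ^ 2) := by
      intro t
      obtain ⟨s, hs, h⟩ := hS ⟨t, rfl⟩
      refine ⟨s, hs, h, ?_⟩
      have h1 := congrArg Prod.fst h
      have h2 := congrArg Prod.snd h
      simp at h1 h2
      linear_combination v.1 * h1 + v.2 * h2
    have hwv : w.1 * v.1 + w.2 * v.2 = 0 := by
      by_contra hne
      obtain ⟨s, hs, -, h⟩ := key (-((a.1 - p.1) * v.1 + (a.2 - p.2) * v.2 + 1) /
        (w.1 * v.1 + w.2 * v.2))
      rw [div_mul_cancel₀ _ hne] at h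
      nlinarith
    obtain ⟨s, -, hs, hs'⟩ := key 0
    obtain ⟨t, -, ht, ht'⟩ := key 1
    rw [hwv] at hs' ht'
    have hst : s = t := mul_right_cancel₀ hn.ne' (by linarith)
    rw [hst, ← ht] at hs
    simp at hs
    exact hw hs
  have h2 : Collinear ℝ (ray p v) := (collinear_line p v).subset (ray_subset_line p v)
  have h3 : ray p v ≠ ∅ := nonempty_iff_ne_empty.1 ⟨p, hp⟩
  have h4 : ¬(ray p v).Subsingleton := fun h => hv (by simpa using h hp hpv)
  simp [shapeOf, h1, h2, h3, h4]

lemma shapeOf_univ : shapeOf univ = .plane := by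
  have h1 : ContainsLine univ := ⟨0, (1, 0), by simp, subset_univ _⟩
  have h2 : ¬Collinear ℝ (univ : Set (ℝ × ℝ)) :=
    not_collinear_of_mem (p := 0) (q := (1, 0)) (r := (0, 1)) (mem_univ _) (mem_univ _) (mem_univ _)
      (by simp)
  simp [shapeOf, h1, h2, isPreconnected_univ]

lemma IsIntersectingLines.shapeOf_eq {S : Set (ℝ × ℝ)} (h : IsIntersectingLines S) :
    shapeOf S = .crossingLines := by
  obtain ⟨p, u, v, huv, rfl⟩ := h
  have hd := det_ne_zero_of_linearIndependent huv
  have h1 : ContainsLine (line p u ∪ line p v) := ⟨p, u, huv.ne_zero 0, subset_union_left⟩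
  have h2 : ¬Collinear ℝ (line p u ∪ line p v) :=
    not_collinear_of_mem (.inl (mem_line_self p u)) (.inl (add_mem_line p u))
      (.inr (add_mem_line p v)) (by simpa using hd)
  have h3 : IsPreconnected (line p u ∪ line p v) :=
    (isPreconnected_line p u).union p (mem_line_self p u) (mem_line_self p v)
      (isPreconnected_line p v)
  have h4 : line p u ∪ line p v ≠ univ := by
    intro h
    rcases (h ▸ mem_univ (p + u + v) : p + u + v ∈ line p u ∪ line p v) with h | h
    · have := det_eq_zero_of_mem_line h
      simp at this
      exact hd (by linarith)
    · have := det_eq_zero_of_mem_line h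
      simp at this
      exact hd (by linarith)
  simp [shapeOf, h1, h2, h3, h4]

lemma shapeOf_parallelLines {p q v : ℝ × ℝ} (hv : v ≠ 0) (h : Disjoint (line p v) (line q v)) :
    shapeOf (line p v ∪ line q v) = .parallelLines := by
  have hd : v.1 * (q.2 - p.2) - v.2 * (q.1 - p.1) ≠ 0 := fun h0 =>
    Set.disjoint_left.1 h (mem_line_of_det_eq_zero hv h0) (mem_line_self q v)
  have h1 : ContainsLine (line p v ∪ line q v) := ⟨p, v, hv, subset_union_left⟩
  have h2 : ¬Collinear ℝ (line p v ∪ line q v) :=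
    not_collinear_of_mem (.inl (mem_line_self p v)) (.inl (add_mem_line p v))
      (.inr (mem_line_self q v)) (by simpa using hd)
  have h3 : ¬IsPreconnected (line p v ∪ line q v) := by
    intro hc
    -- this function is `0` on the first line and `1` on the second one
    set f : ℝ × ℝ → ℝ := fun r => (v.1 * (r.2 - p.2) - v.2 * (r.1 - p.1)) /
      (v.1 * (q.2 - p.2) - v.2 * (q.1 - p.1)) with hf
    have hi := hc.intermediate_value (f := f) (.inl (mem_line_self p v))
      (.inr (mem_line_self q v)) (by fun_prop)
    have hp : f p = 0 := by simp [hf]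
    have hq : f q = 1 := div_self hd
    rw [hp, hq] at hi
    obtain ⟨r, hr, hr2⟩ := hi (⟨by norm_num, by norm_num⟩ : (1 / 2 : ℝ) ∈ Icc (0 : ℝ) 1)
    rcases hr with hr | hr
    · have := det_eq_zero_of_mem_line hr
      rw [hf] at hr2
      simp only [this, zero_div] at hr2
      norm_num at hr2
    · have h0 := det_eq_zero_of_mem_line hr
      have h1 : f r = 1 := by
        rw [← hq, hf]
        simp only
        congr 1
        linarith
      rw [h1] at hr2
      norm_num at hr2
  simp [shapeOf, h1, h2, h3]

lemma IsEllipse.shapeOf_eq {S : Set (ℝ × ℝ)} (h : IsEllipse S) : shapeOf S = .ellipse := by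
  obtain ⟨φ, rfl⟩ := h
  rw [shapeOf_image]
  set C := {p : ℝ × ℝ | p.1 ^ 2 + p.2 ^ 2 = 1} with hC
  have h1 : ¬ContainsLine C := by
    rintro ⟨p, v, hv, hS⟩
    have e0 := hS (mem_line_self p v)
    have e1 := hS (add_mem_line p v)
    have e2 : p + (-1 : ℝ) • v ∈ C := hS ⟨-1, rfl⟩
    simp [hC] at e0 e1 e2
    have := sq_add_sq_pos hv
    nlinarith
  have h2 : ¬Collinear ℝ C :=
    not_collinear_of_mem (p := (1, 0)) (q := (0, 1)) (r := (-1, 0)) (by simp [hC]) (by simp [hC])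
      (by simp [hC]) (by norm_num)
  have h3 : IsCompact C := by
    refine (isCompact_Icc (a := ((-1, -1) : ℝ × ℝ)) (b := (1, 1))).of_isClosed_subset
      (isClosed_eq (by fun_prop) (by fun_prop)) ?_
    rintro ⟨x, y⟩ h
    simp only [hC, mem_ofPred_eq] at h
    refine ⟨⟨?_, ?_⟩, ?_, ?_⟩ <;> simp only <;> nlinarith
  simp [shapeOf, h1, h2, h3]

lemma IsParabola.shapeOf_eq {S : Set (ℝ × ℝ)} (h : IsParabola S) : shapeOf S = .parabola := by
  obtain ⟨φ, rfl⟩ := h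
  rw [shapeOf_image]
  set C := {p : ℝ × ℝ | p.2 = p.1 ^ 2} with hC
  have h1 : ¬ContainsLine C := by
    rintro ⟨p, v, hv, hS⟩
    have e0 := hS (mem_line_self p v)
    have e1 := hS (add_mem_line p v)
    have e2 : p + (-1 : ℝ) • v ∈ C := hS ⟨-1, rfl⟩
    simp [hC] at e0 e1 e2
    have hv1 : v.1 = 0 := by
      have : v.1 ^ 2 = 0 := by nlinarith
      simpa using this
    rw [hv1] at e1
    exact hv (Prod.ext hv1 (by simp; linarith))
  have h2 : ¬Collinear ℝ C :=
    not_collinear_of_mem (p := (0, 0)) (q := (1, 1)) (r := (-1, 1)) (by simp [hC]) (by simp [hC])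
      (by simp [hC]) (by norm_num)
  have h3 : ¬IsCompact C := by
    intro h
    obtain ⟨M, hM⟩ := (h.image continuous_fst).bddAbove
    have : M + 1 ≤ M := hM ⟨(M + 1, (M + 1) ^ 2), rfl, rfl⟩
    linarith
  have h4 : IsPreconnected C := by
    have : C = range fun t : ℝ => (t, t ^ 2) := by
      ext ⟨x, y⟩
      simp [hC, eq_comm]
    rw [this]
    exact isPreconnected_range (by fun_prop)
  simp [shapeOf, h1, h2, h3, h4]

lemma AreHyperbolaBranches.shapeOf_eq {B₁ B₂ : Set (ℝ × ℝ)} (h : AreHyperbolaBranches B₁ B₂) :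
    shapeOf (B₁ ∪ B₂) = .hyperbola := by
  obtain ⟨φ, rfl, rfl⟩ := h
  rw [← image_union, shapeOf_image]
  set C := {p : ℝ × ℝ | p.1 * p.2 = 1 ∧ 0 < p.1} ∪ {p : ℝ × ℝ | p.1 * p.2 = 1 ∧ p.1 < 0} with hC
  have hm : ∀ p ∈ C, p.1 * p.2 = 1 := by
    rintro p (hp | hp)
    · exact hp.1
    · exact hp.1
  have h1 : ¬ContainsLine C := by
    rintro ⟨p, v, hv, hS⟩
    have e0 := hm _ (hS (mem_line_self p v))
    have e1 := hm _ (hS (add_mem_line p v))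
    have e2 := hm _ (hS (⟨-1, rfl⟩ : p + (-1 : ℝ) • v ∈ line p v))
    simp at e1 e2
    have hq : v.1 * v.2 = 0 := by linarith
    have hl : p.1 * v.2 + v.1 * p.2 = 0 := by linarith
    rcases mul_eq_zero.1 hq with h | h
    · have : v.2 = 0 := by
        rw [h] at hl
        have hp : p.1 ≠ 0 := by rintro h0; simp [h0] at e0
        simpa [hp] using hl
      exact hv (Prod.ext h this)
    · have : v.1 = 0 := by
        rw [h] at hl
        have hp : p.2 ≠ 0 := by rintro h0; simp [h0] at e0
        simpa [hp] using hl
      exact hv (Prod.ext this h)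
  have h2 : ¬Collinear ℝ C :=
    not_collinear_of_mem (p := (1, 1)) (q := (-1, -1)) (r := (2, 1 / 2)) (by simp [hC])
      (by simp [hC]) (by simp [hC]) (by norm_num)
  have h3 : ¬IsCompact C := by
    intro h
    obtain ⟨M, hM⟩ := (h.image continuous_fst).bddAbove
    have hM1 : (1 : ℝ) ≤ M := hM ⟨(1, 1), by simp [hC], rfl⟩
    have : M + 1 ≤ M := hM ⟨(M + 1, (M + 1)⁻¹), .inl
      ⟨mul_inv_cancel₀ (by linarith), by simp only; linarith⟩, rfl⟩
    linarith
  have h4 : ¬IsPreconnected C := by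
    intro hc
    have hi := hc.intermediate_value (f := Prod.fst) (a := (-1, -1)) (b := (1, 1))
      (by simp [hC]) (by simp [hC]) continuous_fst.continuousOn
    obtain ⟨r, hr, hr2⟩ := hi (⟨by norm_num, by norm_num⟩ : (0 : ℝ) ∈ Icc (-1 : ℝ) 1)
    have := hm r hr
    rw [hr2] at this
    simp at this
  simp [shapeOf, h1, h2, h3, h4]

/-! ### The forms are mutually exclusive -/

/-- The shape of the critical set that a form prescribes. -/
def Form.criticalShape : Form → Shape
  | .c1 => .empty
  | .c2 => .point
  | .c3 => .ellipse
  | .c4 => .hyperbola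
  | .c5a | .c5b => .crossingLines
  | .c6 => .parabola
  | .c7a => .parallelLines
  | .c7b | .c8a | .c8b | .c8c => .line
  | .c9a | .c9b | .c9c => .plane

lemma HasForm.shapeOf_J0 {F : ℝ × ℝ → ℝ × ℝ} {c : Form} (h : HasForm F c) :
    shapeOf (J0 F) = c.criticalShape := by
  cases c <;> simp only [HasForm] at h <;> simp only [Form.criticalShape]
  case c1 => rw [h.1, shapeOf_empty]
  case c2 => exact h.1.shapeOf_eq
  case c3 => exact h.1.shapeOf_eq
  case c4 =>
    obtain ⟨B₁, B₂, hB, h0, -⟩ := h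
    rw [h0, hB.shapeOf_eq]
  case c5a => exact h.1.shapeOf_eq
  case c5b => exact h.1.shapeOf_eq
  case c6 => exact h.1.shapeOf_eq
  case c7a =>
    obtain ⟨p, q, v, hv, hd, h0, -⟩ := h
    rw [h0, shapeOf_parallelLines hv hd]
  case c7b => exact h.1.1.shapeOf_eq
  case c8a => exact h.1.1.shapeOf_eq
  case c8b => exact h.1.1.shapeOf_eq
  case c8c => exact h.1.1.shapeOf_eq
  case c9a => rw [h.1, shapeOf_univ]
  case c9b => rw [h.1, shapeOf_univ]
  case c9c => rw [h.1, shapeOf_univ]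

/-- A simple line is not a pair of coincident lines: the second differences of an affine function
vanish, those of a nonzero multiple of the square of a nonconstant affine function do not. -/
lemma J0IsCoincidentLines.not_simple {F : ℝ × ℝ → ℝ × ℝ} (h : J0IsCoincidentLines F) :
    ¬J0IsSimpleLine F := by
  rintro ⟨-, m, -, hm⟩
  obtain ⟨-, l, c, hl, hc, hF⟩ := h
  obtain ⟨v, hv⟩ : ∃ v, l.linear v ≠ 0 := by
    by_contra! h0
    exact hl (LinearMap.ext h0)
  have el : ∀ t : ℝ, l (t • v) = t * l.linear v + l 0 := fun t => by
    have := l.map_vadd 0 (t • v)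
    simpa using this
  have em : ∀ t : ℝ, m (t • v) = t * m.linear v + m 0 := fun t => by
    have := m.map_vadd 0 (t • v)
    simpa using this
  have e : ∀ t : ℝ, t * m.linear v + m 0 = c * (t * l.linear v + l 0) ^ 2 := fun t => by
    rw [← em, ← el, ← hm, hF]
  have h2 : c * l.linear v ^ 2 = 0 := by
    linear_combination -(e 1 + e (-1)) / 2 + e 0
  exact mul_ne_zero hc (pow_ne_zero 2 hv) h2

/-- A parabola is not contained in the union of two lines, since a quadratic polynomial has
finitely many roots. -/
lemma not_parabola_subset_lines {p u v : ℝ × ℝ} (hu : u ≠ 0) (hv : v ≠ 0) :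
    ¬{q : ℝ × ℝ | q.2 = q.1 ^ 2} ⊆ line p u ∪ line p v := by
  intro h
  set P : (ℝ × ℝ) → Polynomial ℝ := fun u =>
    .C u.1 * .X ^ 2 + .C (-u.2) * .X + .C (u.2 * p.1 - u.1 * p.2) with hP
  have hne : ∀ u : ℝ × ℝ, u ≠ 0 → P u ≠ 0 := by
    intro u hu h0
    have e2 := congrArg (Polynomial.coeff · 2) h0
    have e1 := congrArg (Polynomial.coeff · 1) h0
    simp [hP, Polynomial.coeff_C] at e1 e2
    exact hu (Prod.ext e2 e1)
  have hz : P u * P v = 0 := by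
    refine Polynomial.funext fun x => ?_
    rw [Polynomial.eval_mul, Polynomial.eval_zero, mul_eq_zero]
    refine (h (rfl : ((x, x ^ 2) : ℝ × ℝ).2 = ((x, x ^ 2) : ℝ × ℝ).1 ^ 2)).imp (fun h => ?_)
      fun h => ?_
    · have := det_eq_zero_of_mem_line h
      simp [hP]
      linarith
    · have := det_eq_zero_of_mem_line h
      simp [hP]
      linarith
  exact (mul_ne_zero (hne u hu) (hne v hv)) hz

lemma IsTwoRays.not_rayAndParabola {S : Set (ℝ × ℝ)} (h : IsTwoRays S) : ¬IsRayAndParabola S := by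
  rintro ⟨_, _, P, -, ⟨φ, rfl⟩, -, hS⟩
  obtain ⟨p, u, v, huv, hS'⟩ := h.image φ.symm
  refine not_parabola_subset_lines (p := p) (huv.ne_zero 0) (huv.ne_zero 1) fun q hq => ?_
  have : q ∈ φ.symm '' S := by
    rw [hS]
    exact ⟨φ q, .inr (mem_image_of_mem φ hq), by simp⟩
  rw [hS'] at this
  exact this.imp (fun h => ray_subset_line _ _ h) fun h => ray_subset_line _ _ h

/-- A map has at most one of the listed forms. -/
lemma HasForm.unique {F : ℝ × ℝ → ℝ × ℝ} {c c' : Form} (h : HasForm F c) (h' : HasForm F c') :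
    c = c' := by
  have hs := h.shapeOf_J0.symm.trans h'.shapeOf_J0
  cases c <;> cases c' <;> simp only [HasForm] at h h' <;> first
    | rfl
    | (simp only [Form.criticalShape, reduceCtorEq] at hs; done)
    | exact (h.2.not_rayAndParabola h'.2).elim
    | exact (h'.2.not_rayAndParabola h.2).elim
    | exact (h.1.not_simple h'.1).elim
    | exact (h'.1.not_simple h.1).elim
    | exact absurd (h.2.shapeOf_eq.symm.trans h'.2.shapeOf_eq) (by simp)

/-! ### Examples -/

lemma isExample_c1 {a b : ℝ} (ha : a ≠ 0) (hb : b ≠ 0) :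
    IsExample (fun p => (1 - a * p.1 ^ 2 + p.2, b * p.1)) .c1 := by
  refine ⟨⟨![-a, 0, 0, 0, 1, 1], ![0, 0, 0, b, 0, 0], by simp [ha], ?_⟩,
    hasForm_c1_model.conj (φ := affineEquivOfDet (-a) 0 0 b 1 0 (by simp [ha, hb]))
      (ψ := affineEquivOfDet 1 0 0 (-1 / a) 0 0 (by simpa using ha)) (by fun_prop) fun p => ?_⟩
  · funext p
    simp [quadMap]
    ring
  · simp only [affineEquivOfDet_apply, Prod.mk.injEq]
    constructor
    · field_simp
      ring
    · ring

lemma isExample_c2 {k : ℝ} (hk : k ≠ 0) (c₁ c₂ : ℝ) :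
    IsExample (fun p => (p.1 ^ 2 - p.2 ^ 2 + c₁, k * p.1 * p.2 + c₂)) .c2 := by
  refine ⟨⟨![1, 0, -1, 0, 0, c₁], ![0, k, 0, 0, 0, c₂], by simp, ?_⟩,
    hasForm_c2_model.conj (φ := affineEquivOfDet 1 0 0 k c₁ c₂ (by simpa using hk))
      (ψ := .refl ℝ _) (by fun_prop) fun p => ?_⟩
  · funext p
    simp [quadMap]
    ring
  · simp only [affineEquivOfDet_apply, AffineEquiv.refl_apply, Prod.mk.injEq]
    constructor <;> ring

lemma isExample_c4 :
    IsExample (fun p => (p.1 ^ 2 + p.2 ^ 2 + 2 * p.1, 2 * p.1 * p.2 - 2 * p.2)) .c4 := by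
  -- the sum and the difference of the coordinates, in source and target, give the normal form
  refine ⟨⟨![1, 0, 1, 2, 0, 0], ![0, 2, 0, 0, -2, 0], by simp, ?_⟩,
    hasForm_c4_model.conj (φ := affineEquivOfDet (1 / 2) (1 / 2) (1 / 2) (-1 / 2) 0 0 (by norm_num))
      (ψ := affineEquivOfDet 1 1 1 (-1) 0 0 (by norm_num)) (by fun_prop) fun p => ?_⟩
  · funext p
    simp [quadMap]
    ring
  · simp only [affineEquivOfDet_apply, Prod.mk.injEq]
    constructor <;> ring

lemma surjective_sq_sub_sq : Function.Surjective fun p : ℝ × ℝ => p.1 ^ 2 - p.2 ^ 2 := by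
  intro t
  refine ⟨((t + 1) / 2, (t - 1) / 2), ?_⟩
  simp only
  ring

end QuadPlane

theorem theorem1 :
    (∀ F : ℝ × ℝ → ℝ × ℝ, IsQuadraticMap F → ∃! c : Form, HasForm F c) ∧
    (∀ a b : ℝ, a ≠ 0 → b ≠ 0 →
      IsExample (fun p => (1 - a * p.1 ^ 2 + p.2, b * p.1)) Form.c1) ∧
    (∀ c₁ c₂ : ℝ,
      IsExample (fun p => (p.1 ^ 2 - p.2 ^ 2 + c₁, 2 * p.1 * p.2 + c₂)) Form.c2) ∧
    (∀ c₁ c₂ : ℝ,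
      IsExample (fun p => (p.1 ^ 2 - p.2 ^ 2 + c₁, p.1 * p.2 + c₂)) Form.c2) ∧
    IsExample (fun p => (p.1 ^ 2 - p.2 ^ 2 + 2 * p.1, 2 * p.1 * p.2 - 2 * p.2)) Form.c3 ∧
    IsExample (fun p => (p.1 ^ 2 + p.2 ^ 2 + 2 * p.1, 2 * p.1 * p.2 - 2 * p.2)) Form.c4 ∧
    IsExample (fun p => (p.1 ^ 2, p.2 ^ 2)) Form.c5a ∧
    IsExample (fun p => (p.1 ^ 2 + p.2, p.2 ^ 2)) Form.c5b ∧
    IsExample (fun p => (1 / 2 * p.1 ^ 2 + p.2, p.1 * p.2)) Form.c6 ∧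
    (∀ ε : ℝ, ε ≠ 0 →
      IsExample (fun p => (1 / 2 * p.1 ^ 2 + ε * p.1, p.1 * p.2 - ε * p.2)) Form.c7a) ∧
    IsExample (fun p => (1 / 2 * p.1 ^ 2, p.1 * p.2)) Form.c7b ∧
    IsExample (fun p => (p.1, p.1 * p.2)) Form.c8a ∧
    IsExample (fun p => (p.1 ^ 2, p.2)) Form.c8b ∧
    IsExample (fun p => (p.1 ^ 2 + p.2 ^ 2, p.2)) Form.c8c ∧
    IsExample (fun p => (p.1 ^ 2 - p.2 ^ 2, 0)) Form.c9a ∧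
    IsExample (fun p => (p.1 ^ 2, 0)) Form.c9b ∧
    IsExample (fun p => (p.1 ^ 2, p.1)) Form.c9c := by
  refine ⟨fun F hF => ?_, fun a b ha hb => isExample_c1 ha hb,
    fun c₁ c₂ => isExample_c2 two_ne_zero c₁ c₂, fun c₁ c₂ => ?_, ⟨?_, hasForm_c3_model⟩,
    isExample_c4, ⟨?_, hasForm_c5a_model⟩, ⟨?_, hasForm_c5b_model⟩, ⟨?_, hasForm_c6_model⟩,
    fun ε hε => ⟨?_, hasForm_c7a_model hε⟩, ⟨?_, hasForm_c7b_model⟩, ⟨?_, hasForm_c8a_model⟩,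
    ⟨?_, hasForm_c8b_model⟩, ⟨?_, ?_⟩,
    ⟨?_, hasForm_c9a_of_surjective (by fun_prop) surjective_sq_sub_sq⟩,
    ⟨?_, hasForm_c9b_of_range (by fun_prop) (fun p => sq_nonneg _)
      fun t ht => ⟨(√t, 0), Real.sq_sqrt ht⟩⟩,
    ⟨?_, hasForm_c9c_model⟩⟩
  · obtain ⟨c, hc⟩ := hF.exists_hasForm
    exact ⟨c, hc, fun c' hc' => hc'.unique hc⟩
  · simpa using isExample_c2 one_ne_zero c₁ c₂
  · exact ⟨![1, 0, -1, 2, 0, 0], ![0, 2, 0, 0, -2, 0], by simp, by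
      funext p; ext <;> simp [quadMap] <;> ring⟩
  · exact ⟨![1, 0, 0, 0, 0, 0], ![0, 0, 1, 0, 0, 0], by simp, by funext p; simp [quadMap]⟩
  · exact ⟨![1, 0, 0, 0, 1, 0], ![0, 0, 1, 0, 0, 0], by simp, by funext p; simp [quadMap]⟩
  · exact ⟨![1 / 2, 0, 0, 0, 1, 0], ![0, 1, 0, 0, 0, 0], by simp, by funext p; simp [quadMap]⟩
  · exact ⟨![1 / 2, 0, 0, ε, 0, 0], ![0, 1, 0, 0, -ε, 0], by simp, by
      funext p; simp [quadMap]; ring⟩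
  · exact ⟨![1 / 2, 0, 0, 0, 0, 0], ![0, 1, 0, 0, 0, 0], by simp, by funext p; simp [quadMap]⟩
  · exact ⟨![0, 0, 0, 1, 0, 0], ![0, 1, 0, 0, 0, 0], by simp, by funext p; simp [quadMap]⟩
  · exact ⟨![1, 0, 0, 0, 0, 0], ![0, 0, 0, 0, 1, 0], by simp, by funext p; simp [quadMap]⟩
  · exact ⟨![1, 0, 1, 0, 0, 0], ![0, 0, 0, 0, 1, 0], by simp, by funext p; simp [quadMap]⟩
  · simpa using hasForm_c8c_model one_ne_zero
  · exact ⟨![1, 0, -1, 0, 0, 0], ![0, 0, 0, 0, 0, 0], by simp, by funext p; simp [quadMap]; ring⟩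
  · exact ⟨![1, 0, 0, 0, 0, 0], ![0, 0, 0, 0, 0, 0], by simp, by funext p; simp [quadMap]⟩
  · exact ⟨![1, 0, 0, 0, 0, 0], ![0, 0, 0, 1, 0, 0], by simp, by funext p; simp [quadMap]⟩
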